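/- Let $G$ be a finite group acting on a finite set $X$. Write $G_x$ for the stabilizer of $x\in X$, $\mathcal O_x$ for its orbit, $X_s$ for the set of points fixed by $s\in G$, and $Z$ for the number of orbits. The Burnside process is the Markov chain on $X$ with transition matrix and stationary distribution $$K(x,y)=\frac1{|G_x|}\sum_{s\in G_x\cap G_y}\frac1{|X_s|},\qquad \pi(x)=\frac1{Z\,|\mathcal O_x|}.$$ The binary Burnside process is the case $X=C_2^n=\{0,1\}^n$, $G=S_n$ permuting the coordinates; here $\pi(x)=\frac{1}{(n+1)\binom{n}{|x|}}$, where $|x|$ is the number of ones in $x$. The $\ell^2$ (chi-square) and $\ell^1$ (total variation) distances to stationarity after $s$ steps from $x$ are $$\chi^2_x(s)=\sum_{y}\frac{(K^s(x,y)-\pi(y))^2}{\pi(y)},\qquad \|K^s_x-\pi\|_{TV}=\frac12\sum_y|K^s(x,y)-\pi(y)|.$$ **Theorem 1.1.** For $1\le j\le n$ let $e_j\in C_2^n$ be the state whose only $1$ is in coordinate $j$ (in particular $e_n=(0,\dots,0,1)$). For the binary Burnside process: 1. For all $n,s\ge 3$ and all $1\le j\le n$, $$5\left(\tfrac14\right)^{2s}\le\chi^2_{e_j}(s)\le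 270\left(\tfrac14\right)^{2s}.$$ 2. Started from a state with a single $1$, a bounded number of steps is necessary and sufficient for mixing in $\ell^2$, and also in $\ell^1$. That is, let $d_{n,j}(s)$ denote either $\chi^2_{e_j}(s)$ or $\|K^s_{e_j}-\pi\|_{TV}$. Then * (sufficient) for every $\varepsilon>0$ there is $s_0$, not depending on $n$ or $j$, such that $d_{n,j}(s)\le\varepsilon$ for all $n\ge3$, $1\le j\le n$ and $s\ge s_0$; * (necessary) for every $s_0$ there is $\delta>0$, not depending on $n$ or $j$, such that $d_{n,j}(s)\ge\delta$ for all $n\ge3$, $1\le j\le n$ and $0\le s\le s_0$. -/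

import Mathlib

open scoped Classical in
/-- Transition matrix of the Burnside process of a finite group `G` acting on a finite set `X`:
from `x` pick `s` uniformly in the stabilizer of `x`, then pick `y` uniformly among the points
fixed by `s`; so `K(x, y) = |G_x|⁻¹ ∑_{s ∈ G_x ∩ G_y} |X_s|⁻¹`. -/
noncomputable def burnsideKernel (G X : Type*) [Group G] [Fintype G] [MulAction G X] :
    Matrix X X ℝ :=
  Matrix.of fun x y =>
    (1 / (Nat.card (MulAction.stabilizer G x) : ℝ)) *
      ∑ s : G with s ∈ MulAction.stabilizer G x ∧ s ∈ MulAction.stabilizer G y,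
        1 / (Nat.card (MulAction.fixedBy X s) : ℝ)

/-- Stationary distribution of the Burnside process: `π(x) = 1 / (Z |O_x|)`, where `Z` is the
number of orbits and `O_x` is the orbit of `x`. -/
noncomputable def burnsideStationary (G X : Type*) [Group G] [MulAction G X] (x : X) : ℝ :=
  1 / ((Nat.card (MulAction.orbitRel.Quotient G X) : ℝ) * (Nat.card (MulAction.orbit G x) : ℝ))

/-- Chi-square distance `∑_y (K^s(x, y) - π(y))² / π(y)`. -/
noncomputable def chiSquareDist {X : Type*} [Fintype X] [DecidableEq X]
    (K : Matrix X X ℝ) (π : X → ℝ) (x : X) (s : ℕ) : ℝ :=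
  ∑ y, ((K ^ s) x y - π y) ^ 2 / π y

/-- Total variation distance `(1/2) ∑_y |K^s(x, y) - π(y)|`. -/
noncomputable def tvDist {X : Type*} [Fintype X] [DecidableEq X]
    (K : Matrix X X ℝ) (π : X → ℝ) (x : X) (s : ℕ) : ℝ :=
  (1 / 2) * ∑ y, |(K ^ s) x y - π y|

/-- Binary `n`-tuples. -/
abbrev BinaryTuple (n : ℕ) : Type := Fin n → Fin 2

/-- The symmetric group on `n` letters, acting on `n`-tuples by permuting the coordinates:
`(σ • x) i = x (σ i)`, which is the right action `x ↦ x^σ` of permutations. -/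
abbrev CoordPerm (n : ℕ) : Type := (Equiv.Perm (Fin n))ᵈᵐᵃ

instance instFintypeCoordPerm (n : ℕ) : Fintype (CoordPerm n) :=
  Fintype.ofEquiv (Equiv.Perm (Fin n)) DomMulAct.mk

/-- Chi-square distance to stationarity, after `s` steps, of the binary Burnside process on
`n`-tuples started from `x`. -/
noncomputable def binaryBurnsideChiSq (n : ℕ) (x : BinaryTuple n) (s : ℕ) : ℝ :=
  chiSquareDist (burnsideKernel (CoordPerm n) (BinaryTuple n))
    (burnsideStationary (CoordPerm n) (BinaryTuple n)) x s

/-- Total variation distance to stationarity, after `s` steps, of the binary Burnside process on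
`n`-tuples started from `x`. -/
noncomputable def binaryBurnsideTV (n : ℕ) (x : BinaryTuple n) (s : ℕ) : ℝ :=
  tvDist (burnsideKernel (CoordPerm n) (BinaryTuple n))
    (burnsideStationary (CoordPerm n) (BinaryTuple n)) x s

/-- The state with a single `1`, in coordinate `j`. -/
def oneOne (n : ℕ) (j : Fin n) : BinaryTuple n := Pi.single j 1

/-! The sum over permutations of the inverse number of invariant two-colourings is a rising
factorial of 1/2. Hence one step of the chain from x acts on the blocks {x = 0} and {x = 1}
separately: each block draws a bias from the arcsine law and then flips independent coins
(`burnsideKernel_eq`, `burnsideKernel_eq_functional`). Consequently K maps a Walsh function of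
degree m to λ_m times itself plus terms of lower degree (`mulVec_walsh_sub_mem`), where λ_m = 0 for
odd m and λ_{2k} = (C(2k,k)/4^k)². In particular λ_2 = 1/4.

Upper bound. K is self-adjoint in L²(π), so the density δ_e/π(e) at e = e_j splits into orthogonal
eigenvectors g_m, one per degree, and χ² is the sum of λ_m^{2s}‖g_m‖² over m ≥ 1. By the reproducing
property ‖g_m‖² = g_m(e), so it suffices to bound point evaluation at e on functions of degree at
most m. Since π is the uniform mixture over p of Bernoulli(p) products, forcing coordinate j to be 1
and averaging over the others turns f into a polynomial P in p of degree at most m with P(0) = f(e)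
and ∫ p P(p)² dp ≤ ‖f‖². The Christoffel function at 0 for the weight p on [0,1] then gives ‖g_m‖² ≤
((m+1)(m+2))²/2 (`sq_apply_oneOne_le`). This grows like m⁴ while λ_m = O(1/m), so for s ≥ 3 the
series is at most a constant times (1/4)^{2s}, uniformly in n.

Lower bound. An explicit three-coordinate eigenfunction for 1/4 is tested against K^s(e,·) − π.
Cauchy–Schwarz gives the χ² bound and the sup norm gives the total variation bound. -/

open Finset

/-! ### Permutation sums and the closed form of the kernel -/

/-- The rising factorial `(1/2)(3/2)⋯(m - 1/2)`. -/
noncomputable def ascHalf (m : ℕ) : ℝ := ∏ i ∈ range m, ((i : ℝ) + 1 / 2)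

lemma ascHalf_zero : ascHalf 0 = 1 := by simp [ascHalf]

lemma ascHalf_succ (m : ℕ) : ascHalf (m + 1) = ascHalf m * (m + 1 / 2) := by
  simp [ascHalf, prod_range_succ]

/-- The number of two-colourings of `α` that are invariant under `σ`. -/
noncomputable def numFixedColorings {α : Type*} (σ : Equiv.Perm α) : ℕ :=
  Nat.card {f : α → Fin 2 // f ∘ σ = f}

/-- The sum over all permutations of the inverse number of invariant two-colourings. -/
noncomputable def permWeight (α : Type*) [Fintype α] [DecidableEq α] : ℝ :=
  ∑ σ : Equiv.Perm α, 1 / (numFixedColorings σ : ℝ)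

lemma numFixedColorings_permCongr {α β : Type*} (e : α ≃ β) (σ : Equiv.Perm α) :
    numFixedColorings (e.permCongr σ) = numFixedColorings σ := by
  refine Nat.card_congr (Equiv.subtypeEquiv (e.symm.arrowCongr (Equiv.refl _)) fun f => ?_)
  constructor
  · intro h
    ext a
    have := congrFun h (e a)
    simpa using congrArg Fin.val this
  · intro h
    ext b
    have := congrFun h (e.symm b)
    simpa using congrArg Fin.val this

lemma permWeight_congr {α β : Type*} [Fintype α] [DecidableEq α] [Fintype β] [DecidableEq β]
    (e : α ≃ β) : permWeight α = permWeight β :=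
  Fintype.sum_equiv e.permCongr _ _ fun σ => by rw [numFixedColorings_permCongr]

/-- The added point is a new fixed point, whose colour is free. -/
lemma numFixedColorings_optionCongr {α : Type*} (e : Equiv.Perm α) :
    numFixedColorings (Equiv.optionCongr e) = 2 * numFixedColorings e := by
  have E : {f : Option α → Fin 2 // f ∘ Equiv.optionCongr e = f} ≃
      Fin 2 × {f : α → Fin 2 // f ∘ e = f} :=
    { toFun := fun f => (f.1 none, ⟨f.1 ∘ some, by
        ext a
        exact congrArg Fin.val (congrFun f.2 (some a))⟩)
      invFun := fun p => ⟨fun o => o.elim p.1 p.2.1, by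
        ext o
        cases o with
        | none => rfl
        | some a => exact congrArg Fin.val (congrFun p.2.2 a)⟩
      left_inv := fun f => by
        ext o
        cases o <;> rfl
      right_inv := fun p => rfl }
  rw [numFixedColorings, Nat.card_congr E, Nat.card_prod, Nat.card_eq_fintype_card,
    Fintype.card_fin, numFixedColorings]

/-- Here `none` is inserted into the cycle of `p`, just before `p`, so its colour is forced to be
that of `p`. -/
lemma numFixedColorings_swap_mul_optionCongr {α : Type*} [DecidableEq α] (e : Equiv.Perm α)
    (p : α) :
    numFixedColorings (Equiv.swap none (some p) * Equiv.optionCongr e) = numFixedColorings e := by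
  have key : ∀ f : Option α → Fin 2, f none = f (some p) →
      ∀ o, f (Equiv.swap none (some p) o) = f o := by
    intro f hf o
    rcases eq_or_ne o none with rfl | h1
    · simp [hf]
    rcases eq_or_ne o (some p) with rfl | h2
    · simp [hf]
    rw [Equiv.swap_apply_of_ne_of_ne h1 h2]
  have hnone : ∀ f : {f : Option α → Fin 2 //
      f ∘ (Equiv.swap none (some p) * Equiv.optionCongr e : Equiv.Perm (Option α)) = f},
      f.1 none = f.1 (some p) := by
    intro f
    have := congrFun f.2 none
    simpa using this.symm
  have E : {f : Option α → Fin 2 //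
      f ∘ (Equiv.swap none (some p) * Equiv.optionCongr e : Equiv.Perm (Option α)) = f} ≃
      {f : α → Fin 2 // f ∘ e = f} :=
    { toFun := fun f => ⟨f.1 ∘ some, by
        funext a
        have h1 := congrFun f.2 (some a)
        have h2 := key f.1 (hnone f) (some (e a))
        simp only [Function.comp_apply, Equiv.Perm.mul_apply, Equiv.optionCongr_apply,
          Option.map_some] at h1 ⊢
        exact h2.symm.trans h1⟩
      invFun := fun g => ⟨fun o => o.elim (g.1 p) g.1, by
        funext o
        have h2 := key (fun o => o.elim (g.1 p) g.1) rfl (Equiv.optionCongr e o)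
        simp only [Function.comp_apply, Equiv.Perm.mul_apply] at h2 ⊢
        rw [h2]
        cases o with
        | none => rfl
        | some a => exact congrFun g.2 a⟩
      left_inv := fun f => by
        apply Subtype.ext
        funext o
        cases o with
        | none => exact (hnone f).symm
        | some a => rfl
      right_inv := fun g => rfl }
  exact Nat.card_congr E

/-- A new point is either a fixed point, contributing the factor 1/2, or is inserted into an
existing cycle in one of `card α` ways at no cost. -/
lemma permWeight_option (α : Type*) [Fintype α] [DecidableEq α] :
    permWeight (Option α) = permWeight α * (Fintype.card α + 1 / 2) := by
  unfold permWeight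
  rw [← Equiv.sum_comp Equiv.Perm.decomposeOption.symm, Fintype.sum_prod_type,
    Fintype.sum_option]
  have h0 : ∀ e : Equiv.Perm α,
      numFixedColorings (Equiv.Perm.decomposeOption.symm (none, e)) = 2 * numFixedColorings e := by
    intro e
    rw [← numFixedColorings_optionCongr]
    simp only [Equiv.Perm.decomposeOption_symm_apply, Equiv.swap_self]
    rfl
  have h1 : ∀ (p : α) (e : Equiv.Perm α),
      numFixedColorings (Equiv.Perm.decomposeOption.symm (some p, e)) = numFixedColorings e := by
    intro p e
    rw [← numFixedColorings_swap_mul_optionCongr e p]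
    simp
  simp only [h0, h1, sum_const, card_univ, nsmul_eq_mul, Nat.cast_mul, Nat.cast_ofNat]
  rw [mul_add, add_comm, mul_comm]
  congr 1
  rw [sum_mul]
  refine sum_congr rfl fun e _ => ?_
  rw [one_div_mul_one_div, mul_comm]

lemma permWeight_fin (m : ℕ) : permWeight (Fin m) = ascHalf m := by
  induction m with
  | zero => simp [permWeight, numFixedColorings, ascHalf]
  | succ m ih =>
    rw [permWeight_congr finSuccEquivLast, permWeight_option, ih, ascHalf_succ, Fintype.card_fin]

lemma permWeight_eq (α : Type*) [Fintype α] [DecidableEq α] :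
    permWeight α = ascHalf (Fintype.card α) := by
  rw [permWeight_congr (Fintype.equivFin α), permWeight_fin]

lemma numFixedColorings_eq_prod {α ι : Type*} [Fintype ι] (c : α → ι) (σ : Equiv.Perm α)
    (g : ∀ k, Equiv.Perm {a // c a = k})
    (hg : ∀ k (a : {a // c a = k}), (g k a : α) = σ a) :
    numFixedColorings σ = ∏ k, numFixedColorings (g k) := by
  have hσ : ∀ a, c (σ a) = c a := fun a => by
    rw [← hg (c a) ⟨a, rfl⟩]
    exact (g (c a) ⟨a, rfl⟩).2
  have E : {f : α → Fin 2 // f ∘ σ = f} ≃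
      ∀ k, {f : {a // c a = k} → Fin 2 // f ∘ g k = f} :=
    { toFun := fun f k => ⟨fun a => f.1 a, by
        funext a
        simp only [Function.comp_apply, hg]
        exact congrFun f.2 a⟩
      invFun := fun h => ⟨fun a => (h (c a)).1 ⟨a, rfl⟩, by
        funext a
        have aux : ∀ k (b : α) (hb : c b = k), (h (c b)).1 ⟨b, rfl⟩ = (h k).1 ⟨b, hb⟩ := by
          rintro k b rfl
          rfl
        rw [Function.comp_apply, aux (c a) (σ a) (hσ a)]
        have h2 := congrFun (h (c a)).2 ⟨a, rfl⟩
        rw [Function.comp_apply] at h2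
        rw [← h2]
        exact congrArg _ (Subtype.ext (hg (c a) ⟨a, rfl⟩).symm)⟩
      left_inv := fun f => rfl
      right_inv := fun h => by
        funext k
        apply Subtype.ext
        funext ⟨a, ha⟩
        subst ha
        rfl }
  rw [numFixedColorings, Nat.card_congr E, Nat.card_pi]
  rfl

lemma card_fixedBy_coordPerm {n : ℕ} (s : CoordPerm n) :
    Nat.card (MulAction.fixedBy (BinaryTuple n) s) = numFixedColorings (DomMulAct.mk.symm s) := by
  rfl

/-- A permutation preserving `c` is an independent choice of a permutation of each fibre, and the
count of invariant colourings is multiplicative over fibres. It is applied to the joint colouring by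
`x` and `y`. -/
lemma sum_stabilizer_eq_prod {n : ℕ} {ι : Type*} [Fintype ι] [DecidableEq ι] (c : Fin n → ι)
    [DecidablePred fun s : CoordPerm n => s ∈ MulAction.stabilizer (CoordPerm n) c] :
    ∑ s : CoordPerm n with s ∈ MulAction.stabilizer (CoordPerm n) c,
      1 / (Nat.card (MulAction.fixedBy (BinaryTuple n) s) : ℝ) =
    ∏ k, ascHalf (Fintype.card {a // c a = k}) := by
  classical
  have h1 : ∏ k, ascHalf (Fintype.card {a // c a = k}) =
      ∑ g : (∀ k, Equiv.Perm {a // c a = k}), ∏ k, 1 / (numFixedColorings (g k) : ℝ) := by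
    simp_rw [← permWeight_eq, permWeight]
    rw [prod_univ_sum]
    simp
  rw [h1, ← Finset.sum_coe_sort]
  let E : {s // s ∈ (univ : Finset (CoordPerm n)).filter
      (fun s => s ∈ MulAction.stabilizer (CoordPerm n) c)} ≃ ∀ k, Equiv.Perm {a // c a = k} :=
    ((Equiv.subtypeEquivRight (fun s => by simp)).trans
      (MulOpposite.opEquiv (α := MulAction.stabilizer (CoordPerm n) c))).trans
      (DomMulAct.stabilizerMulEquiv c).toEquiv
  refine Fintype.sum_equiv E _ _ fun s => ?_
  rw [card_fixedBy_coordPerm, numFixedColorings_eq_prod c (DomMulAct.mk.symm s.1) (E s)]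
  · simp
  · intro k a
    rfl

lemma card_stabilizer_coordPerm {n : ℕ} (x : BinaryTuple n) :
    Nat.card (MulAction.stabilizer (CoordPerm n) x) =
      ∏ b, (Fintype.card {a // x a = b}).factorial := by
  rw [Nat.card_congr MulOpposite.opEquiv,
    Nat.card_congr (DomMulAct.stabilizerMulEquiv x).toEquiv, Nat.card_pi]
  exact prod_congr rfl fun i _ => by rw [Nat.card_eq_fintype_card, Fintype.card_perm]

lemma burnsideKernel_eq {n : ℕ} (x y : BinaryTuple n) :
    burnsideKernel (CoordPerm n) (BinaryTuple n) x y =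
      ∏ b : Fin 2, (∏ c : Fin 2, ascHalf #{i | x i = b ∧ y i = c}) / (#{i | x i = b}).factorial := by
  classical
  have h : ∀ s : CoordPerm n, (s ∈ MulAction.stabilizer (CoordPerm n) x ∧
      s ∈ MulAction.stabilizer (CoordPerm n) y) ↔
      s ∈ MulAction.stabilizer (CoordPerm n) (fun i => (x i, y i)) := by
    intro s
    simp only [DomMulAct.mem_stabilizer_iff, funext_iff, Function.comp_apply, Prod.mk.injEq,
      forall_and]
  rw [burnsideKernel, Matrix.of_apply]
  simp only [h]
  rw [sum_stabilizer_eq_prod, card_stabilizer_coordPerm, prod_div_distrib, Fintype.prod_prod_type,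
    Nat.cast_prod]
  simp only [Fintype.card_subtype, Prod.mk.injEq]
  rw [div_mul_eq_mul_div, one_mul]

/-! ### The arcsine law as an algebraic moment functional -/

/-- Moments of `1 - 2p` for `p` distributed according to the arcsine law. -/
noncomputable def arcsineMoment : ℕ → ℝ
  | 0 => 1
  | 1 => 0
  | a + 2 => (a + 1) / (a + 2) * arcsineMoment a

lemma arcsineMoment_odd (k : ℕ) : arcsineMoment (2 * k + 1) = 0 := by
  induction k with
  | zero => rfl
  | succ k ih =>
    rw [show 2 * (k + 1) + 1 = 2 * k + 1 + 2 by ring, arcsineMoment, ih, mul_zero]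

lemma arcsineMoment_even (k : ℕ) : arcsineMoment (2 * k) = k.centralBinom / 4 ^ k := by
  induction k with
  | zero => simp [arcsineMoment]
  | succ k ih =>
    have h : ((k : ℝ) + 1) * (k + 1).centralBinom = 2 * (2 * k + 1) * k.centralBinom := by
      exact_mod_cast Nat.succ_mul_centralBinom_succ k
    have h' : ((k + 1).centralBinom : ℝ) = 2 * (2 * k + 1) * k.centralBinom / (k + 1) := by
      rw [← h]
      field_simp
    rw [show 2 * (k + 1) = 2 * k + 2 by ring, arcsineMoment, ih, h']
    push_cast
    field_simp
    ring

open Polynomial in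
/-- The moment functional of `1 - 2p` for `p` distributed according to the arcsine law. -/
noncomputable def arcsineFunctional : ℝ[X] →ₗ[ℝ] ℝ :=
  (Polynomial.basisMonomials ℝ).constr ℝ arcsineMoment

section Functional

open Polynomial

lemma arcsineFunctional_monomial (a : ℕ) :
    arcsineFunctional (monomial a 1) = arcsineMoment a := by
  have h := (basisMonomials ℝ).constr_basis ℝ arcsineMoment a
  rwa [coe_basisMonomials] at h

lemma arcsineFunctional_X_pow (a : ℕ) : arcsineFunctional (X ^ a) = arcsineMoment a := by
  rw [X_pow_eq_monomial, arcsineFunctional_monomial]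

/-- Integration by parts against the arcsine density w = (1 − x²)^{-1/2}, up to normalisation, for
which ((1 − x²)w)' = −xw. On monomials it is the recursion defining `arcsineMoment`, so no integral
is needed. -/
lemma arcsineFunctional_pearson (f : ℝ[X]) :
    arcsineFunctional ((1 - X ^ 2) * derivative f) = arcsineFunctional (X * f) := by
  induction f using Polynomial.induction_on' with
  | add p q hp hq => rw [derivative_add, mul_add, mul_add, map_add, map_add, hp, hq]
  | monomial a c =>
    rw [← C_mul_X_pow_eq_monomial, derivative_C_mul, ← smul_eq_C_mul, ← smul_eq_C_mul,
      mul_smul_comm, mul_smul_comm, map_smul, map_smul]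
    congr 1
    rcases a with _ | a
    · simpa [arcsineMoment] using (arcsineFunctional_X_pow 1).symm
    · rw [derivative_X_pow, Nat.add_sub_cancel, mul_left_comm, ← smul_eq_C_mul, map_smul,
        sub_mul, one_mul, ← pow_add, ← pow_succ', map_sub]
      simp only [arcsineFunctional_X_pow]
      rw [add_comm 2 a, show a + 1 + 1 = a + 2 by ring, arcsineMoment]
      have : (a : ℝ) + 2 ≠ 0 := by positivity
      simp only [smul_eq_mul]
      push_cast
      field_simp
      ring

/-- The probabilities of the two colours, in terms of the difference `X = P(0) - P(1)`. -/
noncomputable def colorProb (c : Fin 2) : ℝ[X] := if c = 0 then C (1 / 2) * (1 + X) else C (1 / 2) * (1 - X)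

/-- These are the Beta(1/2,1/2) moments, matching one block of the kernel. They follow from two
linear relations between neighbouring moments: P + Q = 1, and the integration by parts identity. -/
lemma arcsineFunctional_colorProb (i j : ℕ) :
    arcsineFunctional (colorProb 0 ^ i * colorProb 1 ^ j) =
      ascHalf i * ascHalf j / (i + j).factorial := by
  set P := colorProb 0 with hP
  set Q := colorProb 1 with hQ
  have hPQ : P + Q = 1 := by
    have h2 : (C (1 / 2) : ℝ[X]) * 2 = 1 := by
      rw [show (2 : ℝ[X]) = C 2 from rfl, ← C_mul]
      norm_num
    simp only [hP, hQ, colorProb]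
    simp only [if_true, one_ne_zero, if_false]
    linear_combination h2
  have hPm : P - Q = X := by
    have h2 : (C (1 / 2) : ℝ[X]) * 2 = 1 := by
      rw [show (2 : ℝ[X]) = C 2 from rfl, ← C_mul]
      norm_num
    simp only [hP, hQ, colorProb]
    simp only [if_true, one_ne_zero, if_false]
    linear_combination X * h2
  have hdP : derivative P = C (1 / 2) := by simp [hP, colorProb]
  have hdQ : derivative Q = - C (1 / 2) := by simp [hQ, colorProb]
  have hC : (C (1 / 2) : ℝ[X]) * 2 = 1 := by
    rw [show (2 : ℝ[X]) = C 2 from rfl, ← C_mul]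
    norm_num
  have hX : (1 - X ^ 2 : ℝ[X]) = 4 * P * Q := by
    rw [← hPm]
    linear_combination -(1 + P + Q) * hPQ
  have hpow : ∀ (R : ℝ[X]) (k : ℕ), R * derivative (R ^ k) = C (k : ℝ) * R ^ k * derivative R := by
    intro R k
    rcases k with _ | k
    · simp
    · rw [derivative_pow, Nat.add_sub_cancel, pow_succ]
      ring
  have hsum : ∀ i j, arcsineFunctional (P ^ (i + 1) * Q ^ j) +
      arcsineFunctional (P ^ i * Q ^ (j + 1)) = arcsineFunctional (P ^ i * Q ^ j) := by
    intro i j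
    rw [← map_add]
    congr 1
    linear_combination P ^ i * Q ^ j * hPQ
  -- The integration by parts identity for P^i Q^j, rewritten with 1 − X² = 4PQ and X = P − Q.
  have hrec : ∀ i j : ℕ, (2 * i + 1) * arcsineFunctional (P ^ i * Q ^ (j + 1)) =
      (2 * j + 1) * arcsineFunctional (P ^ (i + 1) * Q ^ j) := by
    intro i j
    have h := arcsineFunctional_pearson (P ^ i * Q ^ j)
    have e1 : (1 - X ^ 2) * derivative (P ^ i * Q ^ j) =
        C (2 * i : ℝ) * (P ^ i * Q ^ (j + 1)) - C (2 * j : ℝ) * (P ^ (i + 1) * Q ^ j) := by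
      have hi := hpow P i
      have hj := hpow Q j
      rw [hdP] at hi
      rw [hdQ] at hj
      rw [hX, derivative_mul, C_mul, C_mul, show (C 2 : ℝ[X]) = 2 from rfl]
      linear_combination 4 * Q ^ (j + 1) * hi + 4 * P ^ (i + 1) * hj +
        (2 * C (i : ℝ) * P ^ i * Q ^ (j + 1) - 2 * C (j : ℝ) * P ^ (i + 1) * Q ^ j) * hC
    have e2 : X * (P ^ i * Q ^ j) = P ^ (i + 1) * Q ^ j - P ^ i * Q ^ (j + 1) := by
      rw [← hPm]
      ring
    rw [e1, e2, map_sub, map_sub, ← smul_eq_C_mul, ← smul_eq_C_mul, map_smul, map_smul,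
      smul_eq_mul, smul_eq_mul] at h
    linarith
  have hQstep : ∀ i j : ℕ, arcsineFunctional (P ^ i * Q ^ (j + 1)) =
      (j + 1 / 2) / (i + j + 1) * arcsineFunctional (P ^ i * Q ^ j) := by
    intro i j
    have h1 := hsum i j
    have h2 := hrec i j
    have : (i : ℝ) + j + 1 ≠ 0 := by positivity
    field_simp
    rw [← h1]
    linear_combination h2
  have hPstep : ∀ i j : ℕ, arcsineFunctional (P ^ (i + 1) * Q ^ j) =
      (i + 1 / 2) / (i + j + 1) * arcsineFunctional (P ^ i * Q ^ j) := by
    intro i j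
    have h1 := hsum i j
    have h2 := hrec i j
    have : (i : ℝ) + j + 1 ≠ 0 := by positivity
    field_simp
    rw [← h1]
    linear_combination -h2
  induction j with
  | zero =>
    induction i with
    | zero =>
      have := arcsineFunctional_X_pow 0
      simpa [ascHalf, arcsineMoment] using this
    | succ i ih =>
      rw [hPstep, ih, ascHalf_succ, ascHalf_zero, Nat.add_zero, Nat.add_zero, Nat.factorial_succ]
      push_cast
      field_simp
      ring
  | succ j ih =>
    rw [hQstep, ih, ascHalf_succ, ← add_assoc, Nat.factorial_succ]
    push_cast
    field_simp

/-! ### The kernel as an expectation over two independent biases -/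

open TensorProduct

/-- The product of two copies of the arcsine functional. -/
noncomputable def arcsineFunctional₂ : ℝ[X] ⊗[ℝ] ℝ[X] →ₗ[ℝ] ℝ :=
  LinearMap.mul' ℝ ℝ ∘ₗ TensorProduct.map arcsineFunctional arcsineFunctional

lemma arcsineFunctional₂_tmul (f g : ℝ[X]) :
    arcsineFunctional₂ (f ⊗ₜ g) = arcsineFunctional f * arcsineFunctional g := by
  simp [arcsineFunctional₂]

/-- Embedding of a polynomial in the tensor factor with index `b`. -/
noncomputable def factorEmb (b : Fin 2) : ℝ[X] →ₐ[ℝ] ℝ[X] ⊗[ℝ] ℝ[X] :=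
  if b = 0 then Algebra.TensorProduct.includeLeft else Algebra.TensorProduct.includeRight

lemma arcsineFunctional₂_prod (f : Fin 2 → ℝ[X]) :
    arcsineFunctional₂ (∏ b, factorEmb b (f b)) = ∏ b, arcsineFunctional (f b) := by
  simp [Fin.prod_univ_two, factorEmb, arcsineFunctional₂_tmul]

/-- The sign `1` of the colour `0` and `-1` of the colour `1`. -/
def colorSign (c : Fin 2) : ℝ := if c = 0 then 1 else -1

/-- The Walsh function `y ↦ ∏_{i ∈ S} (-1)^{y_i}`. -/
def walsh {n : ℕ} (S : Finset (Fin n)) (y : BinaryTuple n) : ℝ := ∏ i ∈ S, colorSign (y i)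

lemma prod_fiberwise_pow {n : ℕ} {M : Type*} [CommMonoid M] (x : BinaryTuple n)
    (S : Finset (Fin n)) (v : Fin 2 → M) :
    ∏ i ∈ S, v (x i) = ∏ b, v b ^ #{i ∈ S | x i = b} := by
  rw [← Finset.prod_fiberwise_of_maps_to (t := univ) (g := x) (fun i _ => mem_univ _)]
  refine prod_congr rfl fun b _ => ?_
  rw [prod_congr rfl (g := fun _ => v b), prod_const]
  intro i hi
  rw [(mem_filter.1 hi).2]

lemma burnsideKernel_eq_functional {n : ℕ} (x y : BinaryTuple n) :
    burnsideKernel (CoordPerm n) (BinaryTuple n) x y =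
      arcsineFunctional₂ (∏ i, factorEmb (x i) (colorProb (y i))) := by
  have h : ∏ i, factorEmb (x i) (colorProb (y i)) =
      ∏ b, factorEmb b (∏ c, colorProb c ^ #{i | x i = b ∧ y i = c}) := by
    rw [← Finset.prod_fiberwise_of_maps_to (t := univ) (g := x) (fun i _ => mem_univ _)]
    refine prod_congr rfl fun b _ => ?_
    rw [prod_congr rfl (g := fun i => factorEmb b (colorProb (y i))), ← map_prod,
      prod_fiberwise_pow y]
    · simp only [filter_filter]
    · intro i hi
      rw [(mem_filter.1 hi).2]
  rw [burnsideKernel_eq, h, arcsineFunctional₂_prod]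
  refine prod_congr rfl fun b _ => ?_
  rw [Fin.prod_univ_two, Fin.prod_univ_two, arcsineFunctional_colorProb]
  congr 3
  rw [← card_union_of_disjoint, ← filter_or]
  · congr 1
    ext i
    simp only [mem_filter, mem_univ, true_and, ← and_or_left]
    have : y i = 0 ∨ y i = 1 := by omega
    simp [this]
  · rw [disjoint_filter]
    intro i _ h1 h2
    rw [h1.2] at h2
    exact absurd h2.2 (by decide)

/-- Given the two biases the coordinates are independent: summing out a coordinate outside `S` gives
1, and one inside `S` gives the variable X of the tensor factor `x i`. -/
lemma sum_burnsideKernel_walsh {n : ℕ} (S : Finset (Fin n)) (x : BinaryTuple n) :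
    ∑ y, burnsideKernel (CoordPerm n) (BinaryTuple n) x y * walsh S y =
      ∏ b, arcsineMoment #{i ∈ S | x i = b} := by
  have hC : (C (1 / 2) : ℝ[X]) * 2 = 1 := by
    rw [show (2 : ℝ[X]) = C 2 from rfl, ← C_mul]
    norm_num
  have h1 : ∀ i : Fin n, ∑ c, (if i ∈ S then colorSign c else 1) •
      factorEmb (x i) (colorProb c) = if i ∈ S then factorEmb (x i) X else 1 := by
    intro i
    simp only [← map_smul, ← map_sum]
    split_ifs
    · congr 1
      simp only [Fin.sum_univ_two, colorSign, colorProb, if_true, one_ne_zero, if_false,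
        one_smul, neg_smul]
      linear_combination X * hC
    · rw [← map_one (factorEmb (x i))]
      congr 1
      simp only [Fin.sum_univ_two, colorProb, if_true, one_ne_zero, if_false, one_smul]
      linear_combination hC
  have h2 : ∑ y : BinaryTuple n, walsh S y • ∏ i, factorEmb (x i) (colorProb (y i)) =
      ∏ b, factorEmb b (X ^ #{i ∈ S | x i = b}) := by
    simp only [map_pow]
    rw [← prod_fiberwise_pow x S (fun b => factorEmb b X)]
    have h3 : ∏ i, (if i ∈ S then factorEmb (x i) X else 1) = ∏ i ∈ S, factorEmb (x i) X := by
      rw [prod_ite_mem, univ_inter]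
    rw [← h3, prod_congr rfl (fun i _ => (h1 i).symm), prod_univ_sum]
    simp only [Fintype.piFinset_univ]
    refine sum_congr rfl fun y _ => ?_
    rw [prod_smul, prod_ite_mem, univ_inter, walsh]
  rw [sum_congr rfl (g := fun y => arcsineFunctional₂
    (walsh S y • ∏ i, factorEmb (x i) (colorProb (y i)))), ← map_sum, h2, arcsineFunctional₂_prod]
  · simp only [arcsineFunctional_X_pow]
  · intro y _
    rw [map_smul, burnsideKernel_eq_functional, smul_eq_mul, mul_comm]

end Functional

/-! ### Degree filtration and eigenvalues -/

/-- Span of the Walsh functions of degree less than `m`. -/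
def walshSpan (n m : ℕ) : Submodule ℝ (BinaryTuple n → ℝ) :=
  Submodule.span ℝ (walsh '' {S : Finset (Fin n) | #S < m})

lemma walsh_mem_walshSpan {n m : ℕ} {S : Finset (Fin n)} (hS : #S < m) : walsh S ∈ walshSpan n m :=
  Submodule.subset_span ⟨S, hS, rfl⟩

lemma walshSpan_mono {n m m' : ℕ} (h : m ≤ m') : walshSpan n m ≤ walshSpan n m' :=
  Submodule.span_mono (Set.image_mono fun _ hS => lt_of_lt_of_le hS h)

lemma colorSign_mul_self (c : Fin 2) : colorSign c * colorSign c = 1 := by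
  fin_cases c <;> norm_num [colorSign]

lemma colorSign_mul_of_ne {c d : Fin 2} (h : c ≠ d) : colorSign c * colorSign d = -1 := by
  fin_cases c <;> fin_cases d <;> simp_all [colorSign]

/-- The indicator of agreement with `z` on `S`, as a product. -/
noncomputable def agreeOn {n : ℕ} (S : Finset (Fin n)) (z y : BinaryTuple n) : ℝ :=
  ∏ i ∈ S, (1 + colorSign (z i) * colorSign (y i)) / 2

lemma agreeOn_eq_one {n : ℕ} {S : Finset (Fin n)} {z y : BinaryTuple n}
    (h : ∀ i ∈ S, z i = y i) : agreeOn S z y = 1 := by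
  refine prod_eq_one fun i hi => ?_
  rw [h i hi, colorSign_mul_self]
  norm_num

lemma agreeOn_eq_zero {n : ℕ} {S : Finset (Fin n)} {z y : BinaryTuple n} {i : Fin n}
    (hi : i ∈ S) (h : z i ≠ y i) : agreeOn S z y = 0 := by
  refine prod_eq_zero hi ?_
  rw [colorSign_mul_of_ne h]
  norm_num

lemma agreeOn_eq_sum {n : ℕ} (S : Finset (Fin n)) (z : BinaryTuple n) :
    agreeOn S z = ∑ U ∈ S.powerset, (walsh U z / 2 ^ #S) • walsh U := by
  funext y
  rw [agreeOn, prod_div_distrib, prod_const, prod_one_add, Finset.sum_apply, sum_div]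
  refine sum_congr rfl fun U _ => ?_
  rw [Pi.smul_apply, smul_eq_mul, prod_mul_distrib, walsh, walsh]
  ring

/-- Identifies the leading Walsh coefficient of a subcube indicator; this is what determines the
eigenvalue. -/
lemma agreeOn_sub_mem {n : ℕ} (S : Finset (Fin n)) (z : BinaryTuple n) :
    agreeOn S z - (walsh S z / 2 ^ #S) • walsh S ∈ walshSpan n #S := by
  rw [agreeOn_eq_sum, ← add_sum_erase _ _ (mem_powerset_self S), add_sub_cancel_left]
  refine Submodule.sum_mem _ fun U hU => Submodule.smul_mem _ _ (walsh_mem_walshSpan ?_)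
  rw [mem_erase, mem_powerset] at hU
  exact card_lt_card (Finset.ssubset_iff_subset_ne.2 ⟨hU.2, hU.1⟩)

lemma walshSpan_eq_top (n : ℕ) : walshSpan n (n + 1) = ⊤ := by
  rw [eq_top_iff]
  intro f _
  have h : f = ∑ z, f z • agreeOn univ z := by
    funext y
    rw [Finset.sum_apply, sum_eq_single y]
    · rw [Pi.smul_apply, agreeOn_eq_one fun _ _ => rfl, smul_eq_mul, mul_one]
    · intro z _ hz
      obtain ⟨i, hi⟩ := Function.ne_iff.1 hz
      rw [Pi.smul_apply, agreeOn_eq_zero (mem_univ i) hi, smul_zero]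
    · simp
  rw [h]
  refine Submodule.sum_mem _ fun z _ => Submodule.smul_mem _ _ ?_
  rw [agreeOn_eq_sum]
  refine Submodule.sum_mem _ fun U _ => Submodule.smul_mem _ _ (walsh_mem_walshSpan ?_)
  have := card_le_univ U
  rw [Fintype.card_fin] at this
  omega

/-- The eigenvalue of the binary Burnside process in degree `m`. -/
noncomputable def burnsideEigenvalue (m : ℕ) : ℝ :=
  (∑ a ∈ range (m + 1), (m.choose a : ℝ) *
    ((-1) ^ a * (arcsineMoment a * arcsineMoment (m - a)))) / 2 ^ m

lemma burnsideEigenvalue_odd (k : ℕ) : burnsideEigenvalue (2 * k + 1) = 0 := by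
  rw [burnsideEigenvalue, sum_eq_zero, zero_div]
  intro a ha
  rw [mem_range] at ha
  rcases Nat.even_or_odd' a with ⟨b, rfl | rfl⟩
  · rw [show 2 * k + 1 - 2 * b = 2 * (k - b) + 1 by omega, arcsineMoment_odd]
    ring
  · rw [arcsineMoment_odd]
    ring

lemma sum_range_even {f : ℕ → ℝ} (hf : ∀ i, f (2 * i + 1) = 0) (k : ℕ) :
    ∑ a ∈ range (2 * k + 1), f a = ∑ i ∈ range (k + 1), f (2 * i) := by
  induction k with
  | zero => simp
  | succ k ih =>
    rw [sum_range_succ _ (k + 1), ← ih, show 2 * (k + 1) + 1 = 2 * k + 1 + 1 + 1 by ring,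
      sum_range_succ, sum_range_succ, hf, add_zero]
    rfl

/-- Both sides equal (2i+2j)!/(i!² j!²). This reduces the even eigenvalues to a sum of squared
binomial coefficients. -/
lemma choose_mul_centralBinom_mul (i j : ℕ) :
    (((2 * (i + j)).choose (2 * i) : ℕ) : ℝ) * (i.centralBinom * j.centralBinom) =
      (i + j).centralBinom * ((i + j).choose i : ℝ) ^ 2 := by
  rw [Nat.centralBinom, Nat.centralBinom, Nat.centralBinom, mul_add, Nat.cast_add_choose,
    Nat.cast_add_choose, two_mul i, two_mul j, Nat.cast_add_choose, Nat.cast_add_choose,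
    show i + i + (j + j) = (i + j) + (i + j) by ring, Nat.cast_add_choose]
  have h : ∀ m : ℕ, (m.factorial : ℝ) ≠ 0 := fun m => by exact_mod_cast m.factorial_ne_zero
  have h1 := h i
  have h2 := h j
  have h3 := h (i + j)
  have h4 := h (i + i)
  have h5 := h (j + j)
  field_simp

lemma burnsideEigenvalue_even (k : ℕ) :
    burnsideEigenvalue (2 * k) = (k.centralBinom / 4 ^ k : ℝ) ^ 2 := by
  rw [burnsideEigenvalue, sum_range_even]
  · have h : ∀ i ∈ range (k + 1), ((2 * k).choose (2 * i) : ℝ) *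
        ((-1) ^ (2 * i) * (arcsineMoment (2 * i) * arcsineMoment (2 * k - 2 * i))) =
        k.centralBinom / 4 ^ k * ((k.choose i ^ 2 : ℕ) : ℝ) := by
      intro i hi
      obtain ⟨j, rfl⟩ := Nat.exists_eq_add_of_le (Nat.lt_succ_iff.1 (mem_range.1 hi))
      have := choose_mul_centralBinom_mul i j
      rw [show 2 * (i + j) - 2 * i = 2 * j by omega, arcsineMoment_even, arcsineMoment_even,
        pow_mul, neg_one_sq, one_pow, one_mul, pow_add, Nat.cast_pow]
      field_simp
      linear_combination this
    rw [sum_congr rfl h, ← mul_sum, ← Nat.cast_sum, Nat.sum_range_choose_sq, pow_mul]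
    rw [Nat.centralBinom]
    norm_num
    ring
  · intro i
    rw [arcsineMoment_odd]
    ring

lemma burnsideEigenvalue_zero : burnsideEigenvalue 0 = 1 := by
  simpa using burnsideEigenvalue_even 0

/-- The bound is an equality at k = 1, which preserves the exact rate 1/4. The induction rests on
(2k+1)²(3k+4) ≤ (2k+2)²(3k+1), whose two sides differ by k. -/
lemma burnsideEigenvalue_two_mul_le (k : ℕ) : burnsideEigenvalue (2 * k) ≤ 1 / (3 * k + 1) := by
  rw [burnsideEigenvalue_even]
  induction k with
  | zero => simp
  | succ k ih =>
    have h : ((k : ℝ) + 1) * (k + 1).centralBinom = 2 * (2 * k + 1) * k.centralBinom := by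
      exact_mod_cast Nat.succ_mul_centralBinom_succ k
    have h' : ((k + 1).centralBinom / 4 ^ (k + 1) : ℝ) =
        (2 * k + 1) / (2 * k + 2) * (k.centralBinom / 4 ^ k) := by
      have : ((k + 1).centralBinom : ℝ) = 2 * (2 * k + 1) * k.centralBinom / (k + 1) := by
        rw [← h]
        field_simp
      rw [this]
      field_simp
      ring
    rw [h', mul_pow]
    calc ((2 * (k : ℝ) + 1) / (2 * k + 2)) ^ 2 * (k.centralBinom / 4 ^ k : ℝ) ^ 2
        ≤ ((2 * (k : ℝ) + 1) / (2 * k + 2)) ^ 2 * (1 / (3 * k + 1)) := by gcongr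
      _ ≤ 1 / (3 * ((k + 1 : ℕ) : ℝ) + 1) := by
        rw [div_pow, div_mul_div_comm, div_le_div_iff₀ (by positivity) (by positivity)]
        push_cast
        have : (0 : ℝ) ≤ k := k.cast_nonneg
        nlinarith

/-- The image of `walsh S` at `x` depends only on the set T of ones of `x` within `S`, so it is a
combination of the subcube indicators `agreeOn S (z T)`. Their leading coefficients (−1)^{#T}/2^{#S}
add up to the eigenvalue. -/
lemma mulVec_walsh_sub_mem {n : ℕ} (S : Finset (Fin n)) :
    (burnsideKernel (CoordPerm n) (BinaryTuple n)).mulVec (walsh S) -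
      burnsideEigenvalue #S • walsh S ∈ walshSpan n #S := by
  let z : Finset (Fin n) → BinaryTuple n := fun T i => if i ∈ T then 1 else 0
  let c : ℕ → ℝ := fun a => arcsineMoment a * arcsineMoment (#S - a)
  have h1 : (burnsideKernel (CoordPerm n) (BinaryTuple n)).mulVec (walsh S) =
      ∑ T ∈ S.powerset, c #T • agreeOn S (z T) := by
    funext x
    rw [Matrix.mulVec, dotProduct, sum_burnsideKernel_walsh, Finset.sum_apply,
      sum_eq_single {i ∈ S | x i = 1}]
    · rw [Pi.smul_apply, agreeOn_eq_one, smul_eq_mul, mul_one, Fin.prod_univ_two, mul_comm]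
      · congr 2
        have := card_filter_add_card_filter_not (s := S) (fun i => x i = 1)
        have h0 : ({i ∈ S | x i = 0}) = {i ∈ S | ¬ x i = 1} := by
          refine filter_congr fun i _ => ?_
          omega
        rw [h0]
        omega
      · intro i hi
        simp only [z, mem_filter, hi, true_and]
        split_ifs with h
        · exact h.symm
        · omega
    · intro T hT hne
      have : ∃ i ∈ S, z T i ≠ x i := by
        by_contra! hcon
        apply hne
        ext i
        rw [mem_powerset] at hT
        rw [mem_filter]
        constructor
        · intro hi
          refine ⟨hT hi, ?_⟩
          rw [← hcon i (hT hi)]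
          simp [z, hi]
        · rintro ⟨hiS, hx⟩
          by_contra hi
          have := hcon i hiS
          simp [z, hi, hx] at this
      obtain ⟨i, hi, hne⟩ := this
      rw [Pi.smul_apply, agreeOn_eq_zero hi hne, smul_zero]
    · intro h
      exact absurd (mem_powerset.2 (filter_subset _ _)) h
  have h2 : burnsideEigenvalue #S • walsh S =
      ∑ T ∈ S.powerset, c #T • ((walsh S (z T) / 2 ^ #S) • walsh S) := by
    have h3 : ∀ T ∈ S.powerset, c #T • ((walsh S (z T) / 2 ^ #S) • walsh S) =
        ((-1) ^ #T * c #T / 2 ^ #S) • walsh S := by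
      intro T hT
      have : walsh S (z T) = (-1) ^ #T := by
        rw [walsh, prod_congr rfl (g := fun i => if i ∈ T then (-1 : ℝ) else 1), prod_ite_mem,
          prod_const, inter_eq_right.2 (mem_powerset.1 hT)]
        intro i _
        simp only [z]
        split_ifs <;> simp [colorSign]
      rw [this, smul_smul]
      congr 1
      ring
    rw [sum_congr rfl h3, ← sum_smul, sum_powerset_apply_card (fun a => (-1) ^ a * c a / 2 ^ #S),
      burnsideEigenvalue, sum_div]
    congr 1
    refine sum_congr rfl fun a _ => ?_
    rw [nsmul_eq_mul]
    ring
  rw [h1, h2, ← sum_sub_distrib]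
  refine Submodule.sum_mem _ fun T _ => ?_
  rw [← smul_sub]
  exact Submodule.smul_mem _ _ (agreeOn_sub_mem S (z T))

lemma mulVec_sub_mem {n m : ℕ} {f : BinaryTuple n → ℝ} (hf : f ∈ walshSpan n (m + 1)) :
    (burnsideKernel (CoordPerm n) (BinaryTuple n)).mulVec f - burnsideEigenvalue m • f ∈
      walshSpan n m := by
  have hK : ∀ (k : ℕ) (g : BinaryTuple n → ℝ), g ∈ walshSpan n k →
      (burnsideKernel (CoordPerm n) (BinaryTuple n)).mulVec g ∈ walshSpan n k := by
    intro k g hg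
    induction hg using Submodule.span_induction with
    | mem g hg =>
      obtain ⟨S, hS, rfl⟩ := hg
      have h := walshSpan_mono (le_of_lt hS) (mulVec_walsh_sub_mem S)
      simpa using Submodule.add_mem _ h
        (Submodule.smul_mem _ (burnsideEigenvalue #S) (walsh_mem_walshSpan hS))
    | zero => rw [Matrix.mulVec_zero]; exact Submodule.zero_mem _
    | add g h _ _ hg hh => rw [Matrix.mulVec_add]; exact Submodule.add_mem _ hg hh
    | smul c g _ hg => rw [Matrix.mulVec_smul]; exact Submodule.smul_mem _ _ hg
  induction hf using Submodule.span_induction with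
  | mem g hg =>
    obtain ⟨S, hS, rfl⟩ := hg
    rcases Nat.lt_succ_iff_lt_or_eq.1 hS with h | h
    · exact Submodule.sub_mem _ (hK m _ (walsh_mem_walshSpan h))
        (Submodule.smul_mem _ _ (walsh_mem_walshSpan h))
    · rw [← h]
      exact mulVec_walsh_sub_mem S
  | zero => rw [Matrix.mulVec_zero, smul_zero, sub_zero]; exact Submodule.zero_mem _
  | add g h _ _ hg hh =>
    rw [Matrix.mulVec_add, smul_add, add_sub_add_comm]
    exact Submodule.add_mem _ hg hh
  | smul c g _ hg =>
    rw [Matrix.mulVec_smul, smul_comm, ← smul_sub]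
    exact Submodule.smul_mem _ _ hg

/-! ### Reversibility and normalisation of general Burnside processes -/

section General

variable {G X : Type*} [Group G] [MulAction G X] [Fintype X]

lemma burnsideStationary_pos (x : X) : 0 < burnsideStationary G X x := by
  have h1 : 0 < Nat.card (MulAction.orbitRel.Quotient G X) := by
    have : Nonempty (MulAction.orbitRel.Quotient G X) := ⟨Quotient.mk'' x⟩
    exact Nat.card_pos
  have h2 : 0 < Nat.card (MulAction.orbit G x) := by
    have : Nonempty (MulAction.orbit G x) := ⟨⟨x, MulAction.mem_orbit_self x⟩⟩
    exact Nat.card_pos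
  unfold burnsideStationary
  positivity

lemma burnsideStationary_eq_stabilizer [Fintype G] (x : X) :
    burnsideStationary G X x = Nat.card (MulAction.stabilizer G x) *
      (1 / ((Nat.card (MulAction.orbitRel.Quotient G X) : ℝ) * Nat.card G)) := by
  classical
  have h : Nat.card (MulAction.orbit G x) * Nat.card (MulAction.stabilizer G x) = Nat.card G := by
    simp only [Nat.card_eq_fintype_card]
    exact MulAction.card_orbit_mul_card_stabilizer_eq_card_group G x
  have hs : (Nat.card (MulAction.stabilizer G x) : ℝ) ≠ 0 := by
    exact_mod_cast Nat.card_pos.ne'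
  rw [burnsideStationary, ← h]
  push_cast
  field_simp

lemma burnsideKernel_reversible [Fintype G] (x y : X) :
    burnsideStationary G X x * burnsideKernel G X x y =
      burnsideStationary G X y * burnsideKernel G X y x := by
  have hs : ∀ z : X, (Nat.card (MulAction.stabilizer G z) : ℝ) ≠ 0 := fun z => by
    exact_mod_cast Nat.card_pos.ne'
  have h1 := hs x
  have h2 := hs y
  simp only [burnsideStationary_eq_stabilizer, burnsideKernel, Matrix.of_apply]
  rw [← mul_assoc, ← mul_assoc]
  congr 1
  · field_simp
  · refine sum_congr ?_ fun _ _ => rfl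
    ext s
    simp only [mem_filter, mem_univ, true_and]
    exact and_comm

lemma sum_burnsideStationary [Nonempty X] : ∑ x, burnsideStationary G X x = 1 := by
  classical
  have h : ∀ q : MulAction.orbitRel.Quotient G X,
      ∑ x with (Quotient.mk'' x : MulAction.orbitRel.Quotient G X) = q, burnsideStationary G X x =
        1 / (Nat.card (MulAction.orbitRel.Quotient G X) : ℝ) := by
    intro q
    induction q using Quotient.inductionOn' with
    | h x₀ =>
      have hmem : ∀ x, (Quotient.mk'' x : MulAction.orbitRel.Quotient G X) = Quotient.mk'' x₀ ↔
          x ∈ MulAction.orbit G x₀ := by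
        intro x
        rw [Quotient.eq'']
        exact MulAction.orbitRel_apply
      have hc : #{x | (Quotient.mk'' x : MulAction.orbitRel.Quotient G X) = Quotient.mk'' x₀} =
          Nat.card (MulAction.orbit G x₀) := by
        simp only [hmem]
        rw [← Fintype.card_subtype, Nat.card_eq_fintype_card]
      rw [sum_congr rfl (g := fun _ => burnsideStationary G X x₀), sum_const, hc, nsmul_eq_mul,
        burnsideStationary]
      · have : (Nat.card (MulAction.orbit G x₀) : ℝ) ≠ 0 := by
          have : Nonempty (MulAction.orbit G x₀) := ⟨⟨x₀, MulAction.mem_orbit_self x₀⟩⟩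
          exact_mod_cast Nat.card_pos.ne'
        field_simp
      · intro x hx
        have hx := (hmem x).1 (mem_filter.1 hx).2
        rw [burnsideStationary, burnsideStationary, MulAction.orbit_eq_iff.2 hx]
  rw [← Finset.sum_fiberwise_of_maps_to (t := univ)
    (g := fun x => (Quotient.mk'' x : MulAction.orbitRel.Quotient G X)) (fun i _ => mem_univ _),
    sum_congr rfl (fun q _ => h q), sum_const, nsmul_eq_mul, card_univ, Nat.card_eq_fintype_card]
  have : Nonempty (MulAction.orbitRel.Quotient G X) := ⟨Quotient.mk'' (Classical.arbitrary X)⟩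
  have : (Fintype.card (MulAction.orbitRel.Quotient G X) : ℝ) ≠ 0 := by
    exact_mod_cast Fintype.card_ne_zero
  field_simp

end General

/-! ### The stationary law as a uniform mixture of Bernoulli products -/

lemma integral_pow_mul_one_sub_pow (a b : ℕ) :
    ∫ x in (0 : ℝ)..1, x ^ a * (1 - x) ^ b =
      a.factorial * b.factorial / ((a + b + 1).factorial : ℝ) := by
  have hint : ∀ a b : ℕ, IntervalIntegrable (fun x : ℝ => x ^ a * (1 - x) ^ b)
      MeasureTheory.volume 0 1 := fun a b => by
    apply Continuous.intervalIntegrable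
    fun_prop
  have hsum : ∀ a b : ℕ, (∫ x in (0 : ℝ)..1, x ^ (a + 1) * (1 - x) ^ b) +
      (∫ x in (0 : ℝ)..1, x ^ a * (1 - x) ^ (b + 1)) =
      ∫ x in (0 : ℝ)..1, x ^ a * (1 - x) ^ b := by
    intro a b
    rw [← intervalIntegral.integral_add (hint _ _) (hint _ _)]
    congr 1
    funext x
    ring
  have hrec : ∀ a b : ℕ, (a + 1) * (∫ x in (0 : ℝ)..1, x ^ a * (1 - x) ^ (b + 1)) =
      (b + 1) * (∫ x in (0 : ℝ)..1, x ^ (a + 1) * (1 - x) ^ b) := by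
    intro a b
    have hd : ∀ x ∈ Set.uIcc (0 : ℝ) 1, HasDerivAt (fun x : ℝ => x ^ (a + 1) * (1 - x) ^ (b + 1))
        ((a + 1) * (x ^ a * (1 - x) ^ (b + 1)) - (b + 1) * (x ^ (a + 1) * (1 - x) ^ b)) x := by
      intro x _
      have h1 := hasDerivAt_pow (a + 1) x
      have h2 := ((hasDerivAt_id x).const_sub 1).pow (b + 1)
      refine (h1.mul h2).congr_deriv ?_
      simp
      ring
    have h := intervalIntegral.integral_eq_sub_of_hasDerivAt hd
      (((hint _ _).const_mul _).sub ((hint _ _).const_mul _))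
    rw [intervalIntegral.integral_sub ((hint _ _).const_mul _) ((hint _ _).const_mul _),
      intervalIntegral.integral_const_mul, intervalIntegral.integral_const_mul] at h
    simp at h
    linarith
  induction b generalizing a with
  | zero =>
    simp only [pow_zero, mul_one, integral_pow, Nat.factorial_succ, Nat.add_zero]
    have : (a.factorial : ℝ) ≠ 0 := by exact_mod_cast a.factorial_ne_zero
    push_cast
    simp
    field_simp
  | succ b ih =>
    have h1 := hsum a b
    have h2 := hrec a b
    rw [ih a] at h1
    have h3 : (∫ x in (0 : ℝ)..1, x ^ a * (1 - x) ^ (b + 1)) =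
        (b + 1) / (a + b + 2) * (a.factorial * b.factorial / ((a + b + 1).factorial : ℝ)) := by
      rw [← h1]
      have : (a : ℝ) + b + 2 ≠ 0 := by positivity
      field_simp
      linear_combination h2
    rw [h3, show a + (b + 1) + 1 = a + b + 1 + 1 by ring, Nat.factorial_succ b,
      Nat.factorial_succ (a + b + 1)]
    push_cast
    have : (a : ℝ) + b + 2 ≠ 0 := by positivity
    field_simp
    ring

/-- The probability of `y` under independent coordinates that equal `1` with probability `p`. -/
def bernoulliWeight {n : ℕ} (y : BinaryTuple n) (p : ℝ) : ℝ := ∏ i, if y i = 1 then p else 1 - p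

lemma bernoulliWeight_eq {n : ℕ} (y : BinaryTuple n) (p : ℝ) :
    bernoulliWeight y p = p ^ #{i | y i = 1} * (1 - p) ^ #{i | y i = 0} := by
  rw [bernoulliWeight, prod_fiberwise_pow y univ (fun c => if c = 1 then p else 1 - p),
    Fin.prod_univ_two, mul_comm]
  simp

lemma continuous_bernoulliWeight {n : ℕ} (y : BinaryTuple n) :
    Continuous (bernoulliWeight y) := by
  simp only [funext (bernoulliWeight_eq y)]
  fun_prop

lemma sum_bernoulliWeight {n : ℕ} (p : ℝ) : ∑ y : BinaryTuple n, bernoulliWeight y p = 1 := by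
  have h := prod_univ_sum (ι := Fin n) (fun _ => (univ : Finset (Fin 2)))
    (fun _ c => if c = 1 then p else 1 - p)
  simp only [Fintype.piFinset_univ, Fin.sum_univ_two] at h
  simpa [bernoulliWeight] using h.symm

lemma card_one_add_card_zero {n : ℕ} (y : BinaryTuple n) :
    #{i | y i = 1} + #{i | y i = 0} = n := by
  have h := card_filter_add_card_filter_not (s := (univ : Finset (Fin n))) (fun i => y i = 1)
  rw [card_univ, Fintype.card_fin] at h
  have h0 : #{i | y i = 0} = #{i | ¬ y i = 1} := by
    congr 1
    ext i
    simp only [mem_filter, mem_univ, true_and]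
    omega
  rw [h0, h]

/-- Both sides are constant multiples of (number of ones)!·(number of zeros)! and both sum to 1, so
the constants agree and the orbits need not be counted. -/
lemma burnsideStationary_eq_integral {n : ℕ} (y : BinaryTuple n) :
    burnsideStationary (CoordPerm n) (BinaryTuple n) y =
      ∫ p in (0 : ℝ)..1, bernoulliWeight y p := by
  let u : BinaryTuple n → ℝ := fun y => (#{i | y i = 1}).factorial * (#{i | y i = 0}).factorial
  have h1 : ∀ y, burnsideStationary (CoordPerm n) (BinaryTuple n) y = u y *
      (1 / ((Nat.card (MulAction.orbitRel.Quotient (CoordPerm n) (BinaryTuple n)) : ℝ) *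
        Nat.card (CoordPerm n))) := by
    intro y
    rw [burnsideStationary_eq_stabilizer, card_stabilizer_coordPerm, Fin.prod_univ_two, mul_comm
      (Nat.factorial _)]
    simp only [Fintype.card_subtype, u]
    push_cast
    rfl
  have h2 : ∀ y : BinaryTuple n, ∫ p in (0 : ℝ)..1, bernoulliWeight y p =
      u y * (1 / ((n + 1).factorial : ℝ)) := by
    intro y
    simp only [bernoulliWeight_eq, integral_pow_mul_one_sub_pow, card_one_add_card_zero, u]
    ring
  have s1 := sum_burnsideStationary (G := CoordPerm n) (X := BinaryTuple n)
  have s2 : ∑ y : BinaryTuple n, ∫ p in (0 : ℝ)..1, bernoulliWeight y p = 1 := by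
    rw [← intervalIntegral.integral_finsetSum]
    · simp [sum_bernoulliWeight]
    · exact fun y _ => (continuous_bernoulliWeight y).intervalIntegrable _ _
  rw [sum_congr rfl (fun y _ => h1 y), ← sum_mul] at s1
  rw [sum_congr rfl (fun y _ => h2 y), ← sum_mul] at s2
  rw [h1, h2]
  congr 1
  have hne : ∑ y : BinaryTuple n, u y ≠ 0 := by
    intro h
    rw [h, zero_mul] at s1
    exact zero_ne_one s1
  exact mul_left_cancel₀ hne (s1.trans s2.symm)

/-! ### The Christoffel bound for point evaluation -/

section Christoffel

open Polynomial

/-- The r_i are the coefficients of the polynomial reproducing evaluation at 0 for the weight x on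
[0,1], since ∫ x·x^i·x^k = 1/(i+k+2). This Cauchy system is solved by the partial fractions of g/D,
with g vanishing at 1, …, m and D at −2, …, −(m+2), normalised to be 1 at 0. -/
lemma exists_moment_certificate (m : ℕ) : ∃ r : ℕ → ℝ,
    r 0 = ((m + 1) * (m + 2)) ^ 2 / 2 ∧
    ∀ k ≤ m, ∑ i ∈ range (m + 1), r i / (i + k + 2) = if k = 0 then 1 else 0 := by
  let v : ℕ → ℝ := fun i => -((i : ℝ) + 2)
  let g : ℝ[X] := ∏ k ∈ range m, (X - C ((k : ℝ) + 1))
  have hv : Set.InjOn v (range (m + 1)) := by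
    intro i _ j _ h
    simp only [v] at h
    have : (i : ℝ) = j := by linarith
    exact_mod_cast this
  have hdeg : g.degree < #(range (m + 1)) := by
    simp only [g]
    rw [degree_prod, sum_congr rfl (fun k _ => degree_X_sub_C _), card_range]
    simp only [sum_const, card_range, nsmul_eq_mul, mul_one]
    exact_mod_cast Nat.lt_succ_self m
  have hne : ∀ k : ℕ, ∀ i ∈ range (m + 1), (k : ℝ) ≠ v i := by
    intro k i _ h
    simp only [v] at h
    have h1 : (0 : ℝ) ≤ k := k.cast_nonneg
    have h2 : (0 : ℝ) ≤ i := i.cast_nonneg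
    linarith
  let D : ℝ[X] := Lagrange.nodal (range (m + 1)) v
  have hD : ∀ k : ℕ, D.eval (k : ℝ) ≠ 0 := fun k => Lagrange.eval_nodal_not_at_node (hne k)
  have hg0 : g.eval 0 ≠ 0 := by
    simp only [g, eval_prod, eval_sub, eval_X, eval_C]
    refine prod_ne_zero_iff.2 fun k _ => ?_
    have : (0 : ℝ) ≤ k := k.cast_nonneg
    linarith
  have hval : ∀ k : ℕ, g.eval (k : ℝ) = D.eval (k : ℝ) * ∑ i ∈ range (m + 1),
      Lagrange.nodalWeight (range (m + 1)) v i * ((k : ℝ) - v i)⁻¹ * g.eval (v i) := by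
    intro k
    conv_lhs => rw [Lagrange.eq_interpolate hv hdeg]
    exact Lagrange.eval_interpolate_not_at_node _ (hne k)
  refine ⟨fun i => D.eval 0 / g.eval 0 *
    (Lagrange.nodalWeight (range (m + 1)) v i * g.eval (v i)), ?_, ?_⟩
  -- D(0) = (m+2)! and the nodal weight at −2 is 1/m!. The other factor is g(−2)/g(0) =
  -- (m+1)(m+2)/2.
  · have h1 : D.eval 0 * Lagrange.nodalWeight (range (m + 1)) v 0 = (m + 1) * (m + 2) := by
      have e1 : D.eval 0 = ∏ i ∈ range (m + 1), ((i : ℝ) + 2) := by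
        simp only [D, Lagrange.eval_nodal, v, zero_sub, neg_neg]
      have e2 : Lagrange.nodalWeight (range (m + 1)) v 0 =
          ∏ i ∈ range (m + 1), if i = 0 then (1 : ℝ) else (i : ℝ)⁻¹ := by
        rw [← prod_erase (a := 0) _ (by simp), Lagrange.nodalWeight]
        refine prod_congr rfl fun i hi => ?_
        rw [if_neg (mem_erase.1 hi).1]
        simp [v]
      rw [e1, e2]
      clear * -
      induction m with
      | zero => simp
      | succ m ih =>
        rw [prod_range_succ, prod_range_succ (n := m + 1), mul_mul_mul_comm, ih]
        simp only [Nat.add_eq_zero_iff, one_ne_zero, and_false, if_false]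
        push_cast
        have : (m : ℝ) + 1 ≠ 0 := by positivity
        field_simp
        ring
    have h2 : g.eval (v 0) = g.eval 0 * (((m + 1) * (m + 2)) / 2) := by
      simp only [g, eval_prod, eval_sub, eval_X, eval_C, v]
      clear * -
      induction m with
      | zero => simp
      | succ m ih =>
        rw [prod_range_succ, ih, prod_range_succ]
        push_cast
        ring
    beta_reduce
    rw [h2]
    field_simp
    linear_combination h1
  · intro k hk
    have h := hval k
    have hk' : ∑ i ∈ range (m + 1), D.eval 0 / g.eval 0 *
        (Lagrange.nodalWeight (range (m + 1)) v i * g.eval (v i)) / (i + k + 2) =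
        D.eval 0 / g.eval 0 * ∑ i ∈ range (m + 1),
        Lagrange.nodalWeight (range (m + 1)) v i * ((k : ℝ) - v i)⁻¹ * g.eval (v i) := by
      rw [mul_sum]
      refine sum_congr rfl fun i _ => ?_
      have : (k : ℝ) - v i = i + k + 2 := by simp only [v]; ring
      rw [this]
      ring
    rw [hk']
    rcases k with _ | k
    · simp only [Nat.cast_zero, if_true] at h ⊢
      rw [div_mul_eq_mul_div, ← h, div_self hg0]
    · have h0 : g.eval ((k + 1 : ℕ) : ℝ) = 0 := by
        simp only [g, eval_prod, eval_sub, eval_X, eval_C]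
        refine prod_eq_zero (mem_range.2 hk) ?_
        push_cast
        ring
      rw [h0] at h
      rw [(mul_eq_zero.1 h.symm).resolve_left (hD _), mul_zero, if_neg k.succ_ne_zero]

lemma sq_eval_zero_le {m : ℕ} {P : ℝ[X]} (hP : P.natDegree ≤ m) :
    P.eval 0 ^ 2 ≤ ((m + 1) * (m + 2)) ^ 2 / 2 * ∫ x in (0 : ℝ)..1, x * P.eval x ^ 2 := by
  obtain ⟨r, hr0, hr⟩ := exists_moment_certificate m
  let R : ℝ[X] := ∑ i ∈ range (m + 1), C (r i) * X ^ i
  have hint : ∀ f : ℝ[X], IntervalIntegrable (fun x : ℝ => x * f.eval x)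
      MeasureTheory.volume 0 1 := fun f => by
    apply Continuous.intervalIntegrable
    fun_prop
  have hrep : ∀ Q : ℝ[X], Q.natDegree ≤ m → ∫ x in (0 : ℝ)..1, x * (R * Q).eval x = Q.eval 0 := by
    intro Q hQ
    have e : ∀ x : ℝ, x * (R * Q).eval x = ∑ k ∈ range (m + 1), ∑ i ∈ range (m + 1),
        Q.coeff k * r i * x ^ (i + k + 1) := by
      intro x
      rw [eval_mul, eval_eq_sum_range' (p := Q) (Nat.lt_succ_of_le hQ)]
      simp only [R, eval_finsetSum, eval_mul, eval_C, eval_pow, eval_X]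
      rw [sum_mul_sum, sum_comm, mul_sum]
      refine sum_congr rfl fun k _ => ?_
      rw [mul_sum]
      refine sum_congr rfl fun i _ => ?_
      ring
    have hi : ∀ (c : ℝ) (k : ℕ), IntervalIntegrable (fun x : ℝ => c * x ^ k)
        MeasureTheory.volume 0 1 := fun c k => by
      apply Continuous.intervalIntegrable
      fun_prop
    simp only [e]
    rw [intervalIntegral.integral_finsetSum]
    · rw [sum_congr rfl (g := fun k => Q.coeff k * if k = 0 then 1 else 0)]
      · simp [coeff_zero_eq_eval_zero]
      · intro k hk
        rw [intervalIntegral.integral_finsetSum (fun i _ => hi _ _),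
          ← hr k (Nat.lt_succ_iff.1 (mem_range.1 hk)), mul_sum]
        refine sum_congr rfl fun i _ => ?_
        rw [intervalIntegral.integral_const_mul, integral_pow]
        push_cast
        simp
        ring
    · intro k _
      apply Continuous.intervalIntegrable
      fun_prop
  have hR : R.natDegree ≤ m := by
    refine natDegree_sum_le_of_forall_le _ _ fun i hi => ?_
    exact (natDegree_C_mul_X_pow_le _ _).trans (Nat.lt_succ_iff.1 (mem_range.1 hi))
  have hR0 : R.eval 0 = r 0 := by
    rw [← coeff_zero_eq_eval_zero]
    simp [R, coeff_X_pow]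
  have hr0pos : 0 < r 0 := by
    rw [hr0]
    positivity
  -- The minimiser over t of ∫ x(P − tR)²; nonnegativity of the minimum is the claim.
  set t := P.eval 0 / r 0 with ht
  have hnn : 0 ≤ ∫ x in (0 : ℝ)..1, x * ((P - C t * R) ^ 2).eval x := by
    refine intervalIntegral.integral_nonneg zero_le_one fun x hx => ?_
    rw [eval_pow]
    exact mul_nonneg hx.1 (sq_nonneg _)
  have hexp : ∀ x : ℝ, x * ((P - C t * R) ^ 2).eval x =
      x * (P ^ 2).eval x - 2 * t * (x * (R * P).eval x) + t ^ 2 * (x * (R * R).eval x) := by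
    intro x
    simp only [eval_pow, eval_sub, eval_mul, eval_C]
    ring
  simp only [hexp] at hnn
  rw [intervalIntegral.integral_add (((hint _).sub ((hint _).const_mul _))) ((hint _).const_mul _),
    intervalIntegral.integral_sub (hint _) ((hint _).const_mul _),
    intervalIntegral.integral_const_mul, intervalIntegral.integral_const_mul, hrep P hP,
    hrep R hR, hR0] at hnn
  simp only [eval_pow] at hnn
  rw [← hr0]
  have e : 2 * t * P.eval 0 = 2 * (P.eval 0 ^ 2 / r 0) ∧ t ^ 2 * r 0 = P.eval 0 ^ 2 / r 0 := by
    constructor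
    · rw [ht]; ring
    · rw [ht]; field_simp
  rw [e.1, e.2] at hnn
  have : P.eval 0 ^ 2 / r 0 ≤ ∫ x in (0 : ℝ)..1, x * P.eval x ^ 2 := by linarith
  rwa [div_le_iff₀' hr0pos] at this

/-- The weight of the colour `c` at coordinate `i` when coordinate `j` is forced to be `1` and
the others equal `1` with probability `X`. -/
noncomputable def forcedWeight {n : ℕ} (j i : Fin n) (c : Fin 2) : ℝ[X] :=
  if i = j then (if c = 1 then 1 else 0) else (if c = 1 then X else 1 - X)

/-- The expectation of `f` when coordinate `j` is forced to be `1` and the others independently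
equal `1` with probability `X`. -/
noncomputable def forcedMean {n : ℕ} (j : Fin n) : (BinaryTuple n → ℝ) →ₗ[ℝ] ℝ[X] where
  toFun f := ∑ y, f y • ∏ i, forcedWeight j i (y i)
  map_add' f g := by simp [add_smul, sum_add_distrib]
  map_smul' c f := by simp [smul_sum, mul_smul]

lemma forcedMean_apply {n : ℕ} (j : Fin n) (f : BinaryTuple n → ℝ) :
    forcedMean j f = ∑ y, f y • ∏ i, forcedWeight j i (y i) := rfl

/-- The mean of a Walsh function factors over coordinates: those in `S` give 1 − 2X, or a constant
at `j`, and those outside give 1. -/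
lemma natDegree_forcedMean_le {n m : ℕ} (j : Fin n) {f : BinaryTuple n → ℝ}
    (hf : f ∈ walshSpan n (m + 1)) : (forcedMean j f).natDegree ≤ m := by
  induction hf using Submodule.span_induction with
  | mem g hg =>
    obtain ⟨S, hS, rfl⟩ := hg
    have h : forcedMean j (walsh S) = ∏ i, ∑ c, (if i ∈ S then colorSign c else 1) •
        forcedWeight j i c := by
      rw [prod_univ_sum]
      simp only [Fintype.piFinset_univ, forcedMean_apply]
      refine sum_congr rfl fun y _ => ?_
      rw [prod_smul, prod_ite_mem, univ_inter, walsh]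
    rw [h]
    refine (natDegree_prod_le _ _).trans ?_
    have h1 : ∀ i ∈ (univ : Finset (Fin n)), (∑ c, (if i ∈ S then colorSign c else 1) •
        forcedWeight j i c).natDegree ≤ if i ∈ S then 1 else 0 := by
      intro i _
      rw [Fin.sum_univ_two]
      by_cases hij : i = j
      · simp only [forcedWeight, if_pos hij, zero_ne_one, if_true, if_false, smul_zero, zero_add]
        split_ifs <;> simp [colorSign]
      · simp only [forcedWeight, if_neg hij, zero_ne_one, if_true, if_false]
        split_ifs
        · simp only [colorSign, if_true, if_false, one_ne_zero, one_smul, neg_smul]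
          rw [show (1 - X + -X : ℝ[X]) = C (-2) * X + C 1 by
            rw [C_neg, show (C 2 : ℝ[X]) = 2 from rfl, C_1]; ring]
          exact natDegree_linear_le
        · simp
    refine (sum_le_sum h1).trans ?_
    rw [sum_ite_mem, univ_inter, sum_const, smul_eq_mul, mul_one]
    exact Nat.lt_succ_iff.1 hS
  | zero => simp
  | add g h _ _ hg hh => rw [map_add]; exact natDegree_add_le_of_degree_le hg hh
  | smul c g _ hg => rw [map_smul]; exact (natDegree_smul_le _ _).trans hg

lemma eval_zero_forcedMean {n : ℕ} (j : Fin n) (f : BinaryTuple n → ℝ) :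
    (forcedMean j f).eval 0 = f (oneOne n j) := by
  simp only [forcedMean_apply, eval_finsetSum, eval_smul, eval_prod]
  rw [sum_eq_single (oneOne n j)]
  · rw [prod_eq_one, smul_eq_mul, mul_one]
    intro i _
    by_cases hij : i = j
    · subst hij
      simp [forcedWeight, oneOne]
    · simp [forcedWeight, oneOne, hij]
  · intro y _ hy
    obtain ⟨i, hi⟩ := Function.ne_iff.1 hy
    rw [prod_eq_zero (mem_univ i), smul_zero]
    by_cases hij : i = j
    · subst hij
      simp only [oneOne, Pi.single_eq_same] at hi
      simp [forcedWeight, hi]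
    · have h1 : y i = 1 := by
        simp only [oneOne, Pi.single_eq_of_ne hij] at hi
        omega
      simp [forcedWeight, hij, h1]
  · simp

/-- The left side is the Bernoulli weight restricted to `y j = 1`. This is the source of the weight
x in `sq_eval_zero_le`. -/
lemma mul_prod_forcedWeight_le {n : ℕ} (j : Fin n) (y : BinaryTuple n) {p : ℝ} (h0 : 0 ≤ p)
    (h1 : p ≤ 1) : p * ∏ i, (forcedWeight j i (y i)).eval p ≤ bernoulliWeight y p := by
  have hnn : 0 ≤ bernoulliWeight y p := prod_nonneg fun i _ => by split_ifs <;> linarith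
  rcases eq_or_ne (y j) 1 with hy | hy
  · refine le_of_eq ?_
    rw [bernoulliWeight, ← mul_prod_erase univ _ (mem_univ j), ← mul_prod_erase univ _ (mem_univ j)]
    simp only [forcedWeight, if_true, hy, eval_one, one_mul]
    congr 1
    refine prod_congr rfl fun i hi => ?_
    rw [if_neg (mem_erase.1 hi).1]
    split_ifs <;> simp
  · rw [prod_eq_zero (mem_univ j), mul_zero]
    · exact hnn
    · simp [forcedWeight, hy]

lemma sum_prod_forcedWeight {n : ℕ} (j : Fin n) (p : ℝ) :
    ∑ y : BinaryTuple n, ∏ i, (forcedWeight j i (y i)).eval p = 1 := by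
  have h := prod_univ_sum (ι := Fin n) (fun _ => (univ : Finset (Fin 2)))
    (fun i c => (forcedWeight j i c).eval p)
  simp only [Fintype.piFinset_univ, Fin.sum_univ_two] at h
  rw [← h]
  refine prod_eq_one fun i _ => ?_
  by_cases hij : i = j <;> simp [forcedWeight, hij]

lemma mul_eval_forcedMean_sq_le {n : ℕ} (j : Fin n) (f : BinaryTuple n → ℝ) {p : ℝ}
    (h0 : 0 ≤ p) (h1 : p ≤ 1) :
    p * (forcedMean j f).eval p ^ 2 ≤ ∑ y, f y ^ 2 * bernoulliWeight y p := by
  let w : BinaryTuple n → ℝ := fun y => ∏ i, (forcedWeight j i (y i)).eval p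
  have hw : ∀ y, 0 ≤ w y := fun y => prod_nonneg fun i _ => by
    unfold forcedWeight
    split_ifs <;> simp [h0, h1]
  have he : (forcedMean j f).eval p = ∑ y, f y * w y := by
    simp only [forcedMean_apply, eval_finsetSum, eval_smul, eval_prod, smul_eq_mul, w]
  have hcs : (∑ y, f y * w y) ^ 2 ≤ ∑ y, f y ^ 2 * w y := by
    have h := sum_sq_le_sum_mul_sum_of_sq_le_mul (R := ℝ) (univ : Finset (BinaryTuple n))
      (r := fun y => f y * w y) (f := fun y => f y ^ 2 * w y) (g := w)
      (fun y _ => mul_nonneg (sq_nonneg _) (hw y)) (fun y _ => hw y) (fun y _ => le_of_eq (by ring))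
    rwa [sum_prod_forcedWeight, mul_one] at h
  rw [he]
  calc p * (∑ y, f y * w y) ^ 2 ≤ p * ∑ y, f y ^ 2 * w y := by gcongr
    _ = ∑ y, f y ^ 2 * (p * w y) := by
      rw [mul_sum]
      refine sum_congr rfl fun y _ => ?_
      ring
    _ ≤ ∑ y, f y ^ 2 * bernoulliWeight y p := by
      refine sum_le_sum fun y _ => ?_
      have := mul_prod_forcedWeight_le j y h0 h1
      gcongr

lemma sq_apply_oneOne_le {n m : ℕ} (j : Fin n) {f : BinaryTuple n → ℝ}
    (hf : f ∈ walshSpan n (m + 1)) :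
    f (oneOne n j) ^ 2 ≤ ((m + 1) * (m + 2)) ^ 2 / 2 *
      ∑ y, burnsideStationary (CoordPerm n) (BinaryTuple n) y * f y ^ 2 := by
  have h := sq_eval_zero_le (natDegree_forcedMean_le j hf)
  rw [eval_zero_forcedMean] at h
  refine h.trans (mul_le_mul_of_nonneg_left ?_ (by positivity))
  have hi : ∀ y ∈ (univ : Finset (BinaryTuple n)), IntervalIntegrable
      (fun p => f y ^ 2 * bernoulliWeight y p) MeasureTheory.volume 0 1 := fun y _ =>
    ((continuous_bernoulliWeight y).const_smul (f y ^ 2)).intervalIntegrable _ _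
  have e : ∑ y, burnsideStationary (CoordPerm n) (BinaryTuple n) y * f y ^ 2 =
      ∫ p in (0 : ℝ)..1, ∑ y, f y ^ 2 * bernoulliWeight y p := by
    rw [intervalIntegral.integral_finsetSum hi]
    refine sum_congr rfl fun y _ => ?_
    rw [intervalIntegral.integral_const_mul, burnsideStationary_eq_integral, mul_comm]
  rw [e]
  refine intervalIntegral.integral_mono_on zero_le_one ?_ ?_ fun p hp =>
    mul_eval_forcedMean_sq_le j f hp.1 hp.2
  · apply Continuous.intervalIntegrable
    fun_prop
  · simpa only [Finset.sum_fn] using IntervalIntegrable.sum _ hi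

end Christoffel

/-! ### Spectral decomposition and the upper bound -/

/-- For q in W (N+1) orthogonal to W N, the vector Tq − λ_N q lies in W N; it is also orthogonal to
W N, because T is symmetric and preserves W N. Hence it vanishes, and each orthogonal increment of
the filtration consists of eigenvectors. -/
lemma exists_orthogonal_eigenvector_decomposition {V : Type*} [AddCommGroup V] [Module ℝ V]
    [FiniteDimensional ℝ V] (B : LinearMap.BilinForm ℝ V) (hB : ∀ v w, B v w = B w v)
    (hpos : ∀ v, B v v = 0 → v = 0) (T : V →ₗ[ℝ] V) (hT : ∀ v w, B (T v) w = B v (T w))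
    (W : ℕ → Submodule ℝ V) (hW : W 0 = ⊥) (hmono : Monotone W) (lam : ℕ → ℝ)
    (hlam : ∀ m, ∀ f ∈ W (m + 1), T f - lam m • f ∈ W m) (N : ℕ) :
    ∀ f ∈ W N, ∃ g : ℕ → V, (∀ m, g m ∈ W (m + 1) ∧ T (g m) = lam m • g m ∧
      ∀ w ∈ W m, B w (g m) = 0) ∧ f = ∑ m ∈ range N, g m := by
  have hinv : ∀ m, ∀ w ∈ W m, T w ∈ W m := by
    intro m w hw
    rcases m with _ | m
    · rw [hW, Submodule.mem_bot] at hw ⊢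
      rw [hw, map_zero]
    · have h := Submodule.add_mem _ (hmono (Nat.le_succ m) (hlam m w hw))
        (Submodule.smul_mem _ (lam m) hw)
      rwa [sub_add_cancel] at h
  induction N with
  | zero =>
    intro f hf
    rw [hW, Submodule.mem_bot] at hf
    exact ⟨fun _ => 0, fun m => ⟨Submodule.zero_mem _, by simp, by simp⟩, by simp [hf]⟩
  | succ N ih =>
    intro f hf
    have hdisj : Disjoint (W N) (B.orthogonal (W N)) := by
      rw [Submodule.disjoint_def]
      intro v hv hv'
      exact hpos v (LinearMap.BilinForm.mem_orthogonal_iff.1 hv' v hv)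
    have hcompl := (LinearMap.BilinForm.isCompl_orthogonal_iff_disjoint (B := B) (W := W N)
      (fun v w h => by rw [hB, h])).2 hdisj
    obtain ⟨p, hp, q, hq, hpq⟩ := Submodule.mem_sup.1
      (hcompl.sup_eq_top ▸ Submodule.mem_top : f ∈ W N ⊔ B.orthogonal (W N))
    have hq' : ∀ w ∈ W N, B w q = 0 := fun w hw => LinearMap.BilinForm.mem_orthogonal_iff.1 hq w hw
    have hqW : q ∈ W (N + 1) := by
      have : q = f - p := by rw [← hpq, add_sub_cancel_left]
      rw [this]
      exact Submodule.sub_mem _ hf (hmono (Nat.le_succ N) hp)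
    have hTq : T q = lam N • q := by
      have h1 := hlam N q hqW
      rw [← sub_eq_zero]
      apply hpos
      rw [map_sub (B _), map_smul, ← hT, hq' _ h1, hq' _ (hinv N _ h1), smul_zero, sub_zero]
    obtain ⟨g, hg, hsum⟩ := ih p hp
    refine ⟨fun m => if m = N then q else g m, fun m => ?_, ?_⟩
    · by_cases hm : m = N
      · subst hm
        simp only [if_true]
        exact ⟨hqW, hTq, hq'⟩
      · simp only [if_neg hm]
        exact hg m
    · rw [sum_range_succ, if_pos rfl, ← hpq, hsum]
      congr 1
      refine sum_congr rfl fun m hm => ?_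
      rw [if_neg (mem_range.1 hm).ne]

lemma pow_reversible {X : Type*} [Fintype X] [DecidableEq X] {K : Matrix X X ℝ} {π : X → ℝ}
    (h : ∀ x y, π x * K x y = π y * K y x) (s : ℕ) (x y : X) :
    π x * (K ^ s) x y = π y * (K ^ s) y x := by
  induction s generalizing x y with
  | zero =>
    rcases eq_or_ne x y with rfl | hxy
    · rfl
    · simp [Matrix.one_apply_ne hxy, Matrix.one_apply_ne hxy.symm]
  | succ s ih =>
    rw [pow_succ, Matrix.mul_apply, ← pow_succ, pow_succ', Matrix.mul_apply, mul_sum, mul_sum]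
    refine sum_congr rfl fun z _ => ?_
    rw [← mul_assoc, ih, mul_right_comm, h, ← mul_assoc, mul_right_comm]

/-- The inner product of `L²(π)`. -/
noncomputable def weightedForm {X : Type*} [Fintype X] (π : X → ℝ) :
    LinearMap.BilinForm ℝ (X → ℝ) :=
  LinearMap.mk₂ ℝ (fun f g => ∑ y, π y * f y * g y)
    (fun f g h => by simp only [Pi.add_apply, mul_add, add_mul, sum_add_distrib])
    (fun c f g => by
      simp only [Pi.smul_apply, smul_eq_mul, mul_sum]
      exact sum_congr rfl fun y _ => by ring)
    (fun f g h => by simp only [Pi.add_apply, mul_add, sum_add_distrib])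
    (fun c f g => by
      simp only [Pi.smul_apply, smul_eq_mul, mul_sum]
      exact sum_congr rfl fun y _ => by ring)

lemma weightedForm_apply {X : Type*} [Fintype X] (π : X → ℝ) (f g : X → ℝ) :
    weightedForm π f g = ∑ y, π y * f y * g y := rfl

/-- By reversibility the density K^s(x,·)/π is K^s applied to the density of the point mass at x. -/
lemma chiSquareDist_eq {X : Type*} [Fintype X] [DecidableEq X] {K : Matrix X X ℝ} {π : X → ℝ}
    (hπ : ∀ x, 0 < π x) (h : ∀ x y, π x * K x y = π y * K y x) (x : X) (s : ℕ) :
    chiSquareDist K π x s = weightedForm π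
      ((K.mulVecLin ^ s) (Pi.single x (1 / π x)) - 1) ((K.mulVecLin ^ s) (Pi.single x (1 / π x)) - 1) := by
  rw [weightedForm_apply, chiSquareDist]
  refine sum_congr rfl fun y _ => ?_
  have h1 : (K.mulVecLin ^ s) (Pi.single x (1 / π x)) y = (K ^ s) x y / π y := by
    have hp : K.mulVecLin ^ s = (K ^ s).mulVecLin := (Matrix.toLin'_pow K s).symm
    rw [hp, Matrix.mulVecLin_apply, Matrix.mulVec_single]
    have h2 := pow_reversible h s x y
    have hx := (hπ x).ne'
    have hy := (hπ y).ne'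
    simp
    field_simp
    linarith
  rw [Pi.sub_apply, h1, Pi.one_apply]
  have hy := (hπ y).ne'
  field_simp

lemma walshSpan_zero (n : ℕ) : walshSpan n 0 = ⊥ := by
  simp [walshSpan]

lemma walsh_empty {n : ℕ} : walsh (∅ : Finset (Fin n)) = 1 := by
  funext y
  simp [walsh]

lemma exists_smul_one_of_mem_walshSpan_one {n : ℕ} {f : BinaryTuple n → ℝ}
    (hf : f ∈ walshSpan n 1) : ∃ c : ℝ, c • (1 : BinaryTuple n → ℝ) = f := by
  have h : walshSpan n 1 = Submodule.span ℝ {1} := by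
    rw [walshSpan]
    congr 1
    ext g
    simp only [Set.mem_image, Set.mem_ofPred_eq, Nat.lt_one_iff, card_eq_zero,
      exists_eq_left, walsh_empty, Set.mem_singleton_iff]
    exact eq_comm
  rw [h] at hf
  exact Submodule.mem_span_singleton.1 hf

lemma binaryBurnsideChiSq_le_sum {n : ℕ} (j : Fin n) (s : ℕ) :
    binaryBurnsideChiSq n (oneOne n j) s ≤ ∑ m ∈ range n, burnsideEigenvalue (m + 1) ^ (2 * s) *
      ((((m + 1 : ℕ) : ℝ) + 1) * (((m + 1 : ℕ) : ℝ) + 2)) ^ 2 / 2 := by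
  set K := burnsideKernel (CoordPerm n) (BinaryTuple n) with hK
  set π := burnsideStationary (CoordPerm n) (BinaryTuple n) with hπdef
  set e := oneOne n j with he
  have hπ : ∀ x, 0 < π x := burnsideStationary_pos
  have hrev : ∀ x y, π x * K x y = π y * K y x := burnsideKernel_reversible
  set B := weightedForm π with hBdef
  set T := K.mulVecLin with hTdef
  have hB : ∀ v w, B v w = B w v := fun v w => by
    simp only [hBdef, weightedForm_apply]
    exact sum_congr rfl fun y _ => by ring
  have hnn : ∀ v, 0 ≤ B v v := fun v => by
    rw [hBdef, weightedForm_apply]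
    refine sum_nonneg fun y _ => ?_
    rw [mul_assoc]
    exact mul_nonneg (hπ y).le (mul_self_nonneg _)
  have hpos : ∀ v, B v v = 0 → v = 0 := by
    intro v hv
    rw [hBdef, weightedForm_apply, sum_eq_zero_iff_of_nonneg] at hv
    · funext y
      have h := hv y (mem_univ y)
      rw [mul_assoc] at h
      exact mul_self_eq_zero.1 ((mul_eq_zero.1 h).resolve_left (hπ y).ne')
    · intro y _
      rw [mul_assoc]
      exact mul_nonneg (hπ y).le (mul_self_nonneg _)
  have hT : ∀ v w, B (T v) w = B v (T w) := by
    intro v w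
    simp only [hBdef, weightedForm_apply, hTdef, Matrix.mulVecLin_apply, Matrix.mulVec, dotProduct,
      mul_sum, sum_mul]
    rw [sum_comm]
    refine sum_congr rfl fun y _ => sum_congr rfl fun z _ => ?_
    linear_combination v y * w z * hrev z y
  obtain ⟨g, hg, hsum⟩ := exists_orthogonal_eigenvector_decomposition B hB hpos T hT (walshSpan n)
    (walshSpan_zero n) (fun a b h => walshSpan_mono h) burnsideEigenvalue
    (fun m f hf => mulVec_sub_mem hf) (n + 1) (Pi.single e (1 / π e))
    (walshSpan_eq_top n ▸ Submodule.mem_top)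
  have heval : ∀ f, B (Pi.single e (1 / π e)) f = f e := by
    intro f
    rw [hBdef, weightedForm_apply, sum_eq_single e]
    · rw [Pi.single_eq_same, mul_one_div_cancel (hπ e).ne', one_mul]
    · intro y _ hy
      rw [Pi.single_eq_of_ne hy, mul_zero, zero_mul]
    · simp
  have horth : ∀ l m, l ≠ m → B (g l) (g m) = 0 := by
    intro l m hlm
    rcases lt_or_gt_of_ne hlm with h | h
    · exact (hg m).2.2 _ (walshSpan_mono h (hg l).1)
    · rw [hB]
      exact (hg l).2.2 _ (walshSpan_mono h (hg m).1)
  have hone : (1 : BinaryTuple n → ℝ) ∈ walshSpan n 1 := by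
    rw [← walsh_empty]
    exact walsh_mem_walshSpan (by simp)
  -- `g 0` is constant and the other components are orthogonal to 1, so pairing the decomposition
  -- with 1 fixes the constant.
  have hg0 : g 0 = 1 := by
    obtain ⟨c, hc⟩ := exists_smul_one_of_mem_walshSpan_one (hg 0).1
    have h1 : B 1 (Pi.single e (1 / π e)) = 1 := by rw [hB, heval, Pi.one_apply]
    have h11 : B 1 1 = 1 := by
      rw [hBdef, weightedForm_apply]
      simpa using sum_burnsideStationary (G := CoordPerm n) (X := BinaryTuple n)
    rw [hsum, map_sum, sum_range_succ', sum_eq_zero, zero_add, ← hc, map_smul, h11] at h1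
    · rw [← hc, show c = 1 by simpa using h1, one_smul]
    · intro m _
      exact (hg (m + 1)).2.2 _ (walshSpan_mono (by omega) hone)
  -- Pairing with the point density evaluates at `e`, so g_m(e) = ‖g_m‖². The Christoffel bound then
  -- reads ‖g_m‖⁴ ≤ C‖g_m‖², and one factor cancels.
  have hnorm : ∀ m ∈ range (n + 1), B (g m) (g m) ≤ ((m + 1) * (m + 2)) ^ 2 / 2 := by
    intro m hm
    have h1 : g m e = B (g m) (g m) := by
      rw [← heval (g m), hsum, map_sum, LinearMap.sum_apply, sum_eq_single m]
      · exact fun l _ hl => horth l m hl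
      · exact fun h => absurd hm h
    have h2 := sq_apply_oneOne_le j (hg m).1
    have h3 : ∑ y, π y * g m y ^ 2 = B (g m) (g m) := by
      rw [hBdef, weightedForm_apply]
      exact sum_congr rfl fun y _ => by ring
    rw [h3, ← he, h1, sq] at h2
    rcases (hnn (g m)).eq_or_lt with h | h
    · rw [← h]
      positivity
    · exact le_of_mul_le_mul_right h2 h
  have hpow : ∀ m, (T ^ s) (g m) = burnsideEigenvalue m ^ s • g m := by
    intro m
    clear * - hg
    induction s with
    | zero => simp
    | succ s ih =>
      rw [pow_succ', Module.End.mul_apply, ih, map_smul, (hg m).2.1, smul_smul, pow_succ]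
  have hTs : (T ^ s) (Pi.single e (1 / π e)) - 1 =
      ∑ m ∈ range n, burnsideEigenvalue (m + 1) ^ s • g (m + 1) := by
    rw [hsum, map_sum, sum_range_succ', hpow 0, burnsideEigenvalue_zero, one_pow, one_smul, hg0,
      add_sub_cancel_right]
    exact sum_congr rfl fun m _ => hpow (m + 1)
  rw [binaryBurnsideChiSq, chiSquareDist_eq hπ hrev, hTs, map_sum]
  refine sum_le_sum fun m hm => ?_
  rw [map_sum, LinearMap.sum_apply, sum_eq_single m]
  · rw [map_smul, map_smul, LinearMap.smul_apply, smul_eq_mul, smul_eq_mul, ← mul_assoc, ← pow_add,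
      ← two_mul, mul_div_assoc]
    have h := hnorm (m + 1) (by rw [mem_range] at hm ⊢; omega)
    exact mul_le_mul_of_nonneg_left h ((even_two_mul s).pow_nonneg _)
  · intro l _ hl
    rw [map_smul, map_smul, LinearMap.smul_apply, horth _ _ (by omega)]
    simp
  · exact fun h => absurd hm h

/-- Telescoping: 1/(3n+4)² ≤ 1/((3n+5/2)(3n+11/2)), which is the difference of consecutive terms
2/(3(6n+5)). -/
lemma sum_inv_sq_le (n : ℕ) :
    ∑ i ∈ range n, 1 / (3 * (i : ℝ) + 4) ^ 2 ≤ 2 / 15 - 2 / (3 * (6 * (n : ℝ) + 5)) := by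
  induction n with
  | zero => norm_num
  | succ n ih =>
    rw [sum_range_succ]
    have h : 1 / (3 * (n : ℝ) + 4) ^ 2 ≤
        2 / (3 * (6 * n + 5)) - 2 / (3 * (6 * ((n + 1 : ℕ) : ℝ) + 5)) := by
      push_cast
      rw [div_sub_div _ _ (by positivity) (by positivity),
        div_le_div_iff₀ (by positivity) (by positivity)]
      have : (0 : ℝ) ≤ n := n.cast_nonneg
      nlinarith
    linarith

/-- Six powers of the eigenvalue ratio 4/(3i+4) absorb the fourth-power growth of the Christoffel
bound and leave a summable inverse square; this is where s ≥ 3 enters. The constant is 1152 =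
4⁶·9/32. -/
lemma eigenvalue_pow_mul_le {s : ℕ} (hs : 3 ≤ s) (i : ℕ) :
    burnsideEigenvalue (2 * (i + 1)) ^ (2 * s) *
      ((((2 * (i + 1) : ℕ) : ℝ) + 1) * (((2 * (i + 1) : ℕ) : ℝ) + 2)) ^ 2 / 2 ≤
    (1 / 4) ^ (2 * s) * (1152 * (1 / (3 * (i : ℝ) + 4) ^ 2)) := by
  have hi : (0 : ℝ) ≤ i := i.cast_nonneg
  have h0 : 0 ≤ burnsideEigenvalue (2 * (i + 1)) := by
    rw [burnsideEigenvalue_even]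
    positivity
  have h1 : burnsideEigenvalue (2 * (i + 1)) ≤ 1 / 4 * (4 / (3 * i + 4)) := by
    refine (burnsideEigenvalue_two_mul_le (i + 1)).trans (le_of_eq ?_)
    push_cast
    field_simp
    ring
  have h2 : (4 / (3 * (i : ℝ) + 4)) ^ (2 * s) ≤ (4 / (3 * (i : ℝ) + 4)) ^ 6 := by
    refine pow_le_pow_of_le_one (by positivity) ?_ (by omega)
    rw [div_le_one (by positivity)]
    linarith
  have h3 : ((((2 * (i + 1) : ℕ) : ℝ) + 1) * (((2 * (i + 1) : ℕ) : ℝ) + 2)) ^ 2 / 2 ≤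
      9 / 32 * (3 * (i : ℝ) + 4) ^ 4 := by
    have h : ((((2 * (i + 1) : ℕ) : ℝ) + 1) * (((2 * (i + 1) : ℕ) : ℝ) + 2)) ≤
        3 / 4 * (3 * (i : ℝ) + 4) ^ 2 := by
      push_cast
      nlinarith
    have := pow_le_pow_left₀ (by positivity) h 2
    linear_combination this / 2
  calc _ = burnsideEigenvalue (2 * (i + 1)) ^ (2 * s) *
      (((((2 * (i + 1) : ℕ) : ℝ) + 1) * (((2 * (i + 1) : ℕ) : ℝ) + 2)) ^ 2 / 2) := by
        rw [mul_div_assoc]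
    _ ≤ ((1 / 4) ^ (2 * s) * (4 / (3 * (i : ℝ) + 4)) ^ 6) * (9 / 32 * (3 * (i : ℝ) + 4) ^ 4) := by
      refine mul_le_mul ?_ h3 (by positivity) (by positivity)
      refine (pow_le_pow_left₀ h0 h1 _).trans ?_
      rw [mul_pow]
      gcongr
    _ = _ := by
      field_simp
      ring

lemma binaryBurnsideChiSq_le {n s : ℕ} (hs : 3 ≤ s) (j : Fin n) :
    binaryBurnsideChiSq n (oneOne n j) s ≤ 270 * (1 / 4 : ℝ) ^ (2 * s) := by
  let F : ℕ → ℝ := fun m => burnsideEigenvalue m ^ (2 * s) * (((m : ℝ) + 1) * ((m : ℝ) + 2)) ^ 2 / 2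
  have hF : ∀ m, 0 ≤ F m := fun m => by
    have := (even_two_mul s).pow_nonneg (burnsideEigenvalue m)
    positivity
  have hodd : ∀ i, F (2 * i + 1) = 0 := fun i => by
    simp only [F]
    rw [burnsideEigenvalue_odd, zero_pow (by omega), zero_mul, zero_div]
  -- The degrees 1, …, n are enlarged to 1, …, 2n, where the odd ones contribute nothing.
  have h1 : ∑ m ∈ range n, F (m + 1) ≤ ∑ i ∈ range n, F (2 * (i + 1)) := by
    have h := sum_range_even hodd n
    rw [sum_range_succ', sum_range_succ' (n := n), mul_zero, add_left_inj] at h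
    rw [← h]
    exact sum_le_sum_of_subset_of_nonneg (range_subset_range.2 (by omega)) fun m _ _ => hF _
  refine (binaryBurnsideChiSq_le_sum j s).trans (h1.trans ?_)
  refine (sum_le_sum fun i _ => eigenvalue_pow_mul_le hs i).trans ?_
  rw [← mul_sum, ← mul_sum, mul_comm]
  refine mul_le_mul_of_nonneg_right ?_ (by positivity)
  have h2 := sum_inv_sq_le n
  have h3 : (0 : ℝ) ≤ 2 / (3 * (6 * n + 5)) := by positivity
  linarith

/-! ### An explicit eigenfunction and the lower bounds -/

lemma mulVec_one {n : ℕ} : (burnsideKernel (CoordPerm n) (BinaryTuple n)).mulVec 1 = 1 := by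
  funext x
  have h := sum_burnsideKernel_walsh ∅ x
  rw [walsh_empty] at h
  rw [Matrix.mulVec, dotProduct, h]
  simp [arcsineMoment]

lemma mulVec_walsh_pair {n : ℕ} {a b : Fin n} (hab : a ≠ b) :
    (burnsideKernel (CoordPerm n) (BinaryTuple n)).mulVec (walsh {a, b}) =
      (1 / 4 : ℝ) • (1 + walsh {a, b}) := by
  funext x
  rw [Matrix.mulVec, dotProduct, sum_burnsideKernel_walsh, Fin.prod_univ_two, Pi.smul_apply,
    Pi.add_apply, Pi.one_apply, walsh, prod_pair hab]
  have ha : x a = 0 ∨ x a = 1 := by omega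
  have hb : x b = 0 ∨ x b = 1 := by omega
  rcases ha with ha | ha <;> rcases hb with hb | hb <;>
    simp [filter_insert, filter_singleton, ha, hb, colorSign, card_pair hab, arcsineMoment] <;>
    norm_num

/-- An eigenfunction for the eigenvalue `1/4` that depends on three coordinates. -/
noncomputable def tripleFunction {n : ℕ} (j i k : Fin n) : BinaryTuple n → ℝ :=
  walsh {i, k} - walsh {j, i} - walsh {j, k} + (1 / 3 : ℝ) • 1

lemma tripleFunction_apply {n : ℕ} {j i k : Fin n} (hji : j ≠ i) (hjk : j ≠ k) (hik : i ≠ k)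
    (y : BinaryTuple n) : tripleFunction j i k y =
    colorSign (y i) * colorSign (y k) - colorSign (y j) * colorSign (y i) -
      colorSign (y j) * colorSign (y k) + 1 / 3 := by
  simp [tripleFunction, walsh, hji, hjk, hik]

lemma tripleFunction_eq_or {n : ℕ} {j i k : Fin n} (hji : j ≠ i) (hjk : j ≠ k) (hik : i ≠ k)
    (y : BinaryTuple n) : tripleFunction j i k y = 10 / 3 ∨ tripleFunction j i k y = -2 / 3 := by
  rw [tripleFunction_apply hji hjk hik]
  unfold colorSign
  split_ifs <;> norm_num

lemma tripleFunction_oneOne {n : ℕ} {j i k : Fin n} (hji : j ≠ i) (hjk : j ≠ k) (hik : i ≠ k) :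
    tripleFunction j i k (oneOne n j) = 10 / 3 := by
  rw [tripleFunction_apply hji hjk hik]
  simp [oneOne, hji.symm, hjk.symm, colorSign]
  norm_num

/-- The three pair terms produce a net constant −1/4, and the summand c = 1/3 solves c − 1/4 = c/4.
-/
lemma mulVec_tripleFunction {n : ℕ} {j i k : Fin n} (hji : j ≠ i) (hjk : j ≠ k) (hik : i ≠ k) :
    (burnsideKernel (CoordPerm n) (BinaryTuple n)).mulVec (tripleFunction j i k) =
      (1 / 4 : ℝ) • tripleFunction j i k := by
  rw [tripleFunction, Matrix.mulVec_add, Matrix.mulVec_sub, Matrix.mulVec_sub, Matrix.mulVec_smul,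
    mulVec_one, mulVec_walsh_pair hji, mulVec_walsh_pair hjk, mulVec_walsh_pair hik]
  module

lemma pow_mulVec_eigenvector {X : Type*} [Fintype X] [DecidableEq X] {K : Matrix X X ℝ}
    {f : X → ℝ} {c : ℝ} (h : K.mulVec f = c • f) (s : ℕ) : (K ^ s).mulVec f = c ^ s • f := by
  induction s with
  | zero => simp
  | succ s ih =>
    rw [pow_succ, ← Matrix.mulVec_mulVec, h, Matrix.mulVec_smul, ih, smul_smul, pow_succ']

lemma sum_burnsideStationary_mul_mulVec {n : ℕ} (f : BinaryTuple n → ℝ) :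
    ∑ y, burnsideStationary (CoordPerm n) (BinaryTuple n) y *
      (burnsideKernel (CoordPerm n) (BinaryTuple n)).mulVec f y =
    ∑ y, burnsideStationary (CoordPerm n) (BinaryTuple n) y * f y := by
  simp only [Matrix.mulVec, dotProduct, mul_sum]
  rw [sum_comm]
  refine sum_congr rfl fun z _ => ?_
  have h := congrFun (mulVec_one (n := n)) z
  simp only [Matrix.mulVec, dotProduct, Pi.one_apply, mul_one] at h
  rw [← mul_one (burnsideStationary (CoordPerm n) (BinaryTuple n) z), ← h, mul_sum, sum_mul]
  refine sum_congr rfl fun y _ => ?_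
  rw [burnsideKernel_reversible z y, mul_assoc]

/-- Stationarity makes the mean equal to a quarter of itself. -/
lemma sum_burnsideStationary_tripleFunction {n : ℕ} {j i k : Fin n} (hji : j ≠ i) (hjk : j ≠ k)
    (hik : i ≠ k) :
    ∑ y, burnsideStationary (CoordPerm n) (BinaryTuple n) y * tripleFunction j i k y = 0 := by
  have h := sum_burnsideStationary_mul_mulVec (tripleFunction j i k)
  rw [mulVec_tripleFunction hji hjk hik] at h
  simp only [Pi.smul_apply, smul_eq_mul, mul_left_comm _ (1 / 4 : ℝ)] at h
  rw [← mul_sum] at h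
  linarith

lemma sum_burnsideStationary_tripleFunction_sq {n : ℕ} {j i k : Fin n} (hji : j ≠ i)
    (hjk : j ≠ k) (hik : i ≠ k) :
    ∑ y, burnsideStationary (CoordPerm n) (BinaryTuple n) y * tripleFunction j i k y ^ 2 =
      20 / 9 := by
  -- The function takes only the values 10/3 and −2/3, the roots of t² = 20/9 + (8/3)t.
  have h : ∀ y, burnsideStationary (CoordPerm n) (BinaryTuple n) y * tripleFunction j i k y ^ 2 =
      20 / 9 * burnsideStationary (CoordPerm n) (BinaryTuple n) y +
      8 / 3 * (burnsideStationary (CoordPerm n) (BinaryTuple n) y * tripleFunction j i k y) := by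
    intro y
    rcases tripleFunction_eq_or hji hjk hik y with h | h <;> rw [h] <;> ring
  rw [sum_congr rfl (fun y _ => h y), sum_add_distrib, ← mul_sum, ← mul_sum,
    sum_burnsideStationary, sum_burnsideStationary_tripleFunction hji hjk hik]
  norm_num

lemma sum_sub_mul_tripleFunction {n : ℕ} {j i k : Fin n} (hji : j ≠ i) (hjk : j ≠ k)
    (hik : i ≠ k) (s : ℕ) :
    ∑ y, ((burnsideKernel (CoordPerm n) (BinaryTuple n) ^ s) (oneOne n j) y -
      burnsideStationary (CoordPerm n) (BinaryTuple n) y) * tripleFunction j i k y =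
      (1 / 4 : ℝ) ^ s * (10 / 3) := by
  have h := congrFun (pow_mulVec_eigenvector (mulVec_tripleFunction hji hjk hik) s) (oneOne n j)
  rw [Pi.smul_apply, tripleFunction_oneOne hji hjk hik, smul_eq_mul] at h
  simp only [sub_mul, sum_sub_distrib]
  rw [sum_burnsideStationary_tripleFunction hji hjk hik, sub_zero, ← h]
  rfl

lemma exists_distinct_triple {n : ℕ} (hn : 3 ≤ n) (j : Fin n) :
    ∃ i k : Fin n, j ≠ i ∧ j ≠ k ∧ i ≠ k := by
  have h : 1 < #(univ.erase j) := by
    rw [card_erase_of_mem (mem_univ j), card_univ, Fintype.card_fin]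
    omega
  obtain ⟨i, hi, k, hk, hik⟩ := one_lt_card.1 h
  exact ⟨i, k, (mem_erase.1 hi).1.symm, (mem_erase.1 hk).1.symm, hik⟩

/-- Cauchy–Schwarz against the eigenfunction; the constant is 5 = (10/3)²/(20/9). -/
lemma le_binaryBurnsideChiSq {n : ℕ} (hn : 3 ≤ n) (j : Fin n) (s : ℕ) :
    5 * (1 / 4 : ℝ) ^ (2 * s) ≤ binaryBurnsideChiSq n (oneOne n j) s := by
  obtain ⟨i, k, hji, hjk, hik⟩ := exists_distinct_triple hn j
  set K := burnsideKernel (CoordPerm n) (BinaryTuple n) with hK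
  set π := burnsideStationary (CoordPerm n) (BinaryTuple n) with hπdef
  have hπ : ∀ x, 0 < π x := burnsideStationary_pos
  have h := sum_sq_le_sum_mul_sum_of_sq_le_mul (univ : Finset (BinaryTuple n))
    (r := fun y => ((K ^ s) (oneOne n j) y - π y) * tripleFunction j i k y)
    (f := fun y => ((K ^ s) (oneOne n j) y - π y) ^ 2 / π y)
    (g := fun y => π y * tripleFunction j i k y ^ 2)
    (fun y _ => div_nonneg (sq_nonneg _) (hπ y).le)
    (fun y _ => mul_nonneg (hπ y).le (sq_nonneg _))
    (fun y _ => by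
      have := (hπ y).ne'
      refine le_of_eq ?_
      field_simp)
  rw [sum_sub_mul_tripleFunction hji hjk hik, sum_burnsideStationary_tripleFunction_sq hji hjk hik,
    mul_pow, ← pow_mul, mul_comm s 2] at h
  rw [binaryBurnsideChiSq, chiSquareDist]
  linarith

lemma le_binaryBurnsideTV {n : ℕ} (hn : 3 ≤ n) (j : Fin n) (s : ℕ) :
    1 / 2 * (1 / 4 : ℝ) ^ s ≤ binaryBurnsideTV n (oneOne n j) s := by
  obtain ⟨i, k, hji, hjk, hik⟩ := exists_distinct_triple hn j
  have h := sum_sub_mul_tripleFunction hji hjk hik s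
  have habs : ∀ y, |tripleFunction j i k y| ≤ 10 / 3 := by
    intro y
    rcases tripleFunction_eq_or hji hjk hik y with h | h <;> rw [h, abs_le] <;> norm_num
  rw [binaryBurnsideTV, tvDist]
  have h2 : (1 / 4 : ℝ) ^ s * (10 / 3) ≤
      ∑ y, |(burnsideKernel (CoordPerm n) (BinaryTuple n) ^ s) (oneOne n j) y -
        burnsideStationary (CoordPerm n) (BinaryTuple n) y| * (10 / 3) := by
    rw [← h]
    refine sum_le_sum fun y _ => (le_abs_self _).trans ?_
    rw [abs_mul]
    gcongr
    exact habs y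
  rw [← sum_mul] at h2
  linarith

/-! ### Comparison of the two distances and conclusion -/

lemma two_mul_tvDist_sq_le {n : ℕ} (x : BinaryTuple n) (s : ℕ) :
    (2 * binaryBurnsideTV n x s) ^ 2 ≤ binaryBurnsideChiSq n x s := by
  set K := burnsideKernel (CoordPerm n) (BinaryTuple n) with hK
  set π := burnsideStationary (CoordPerm n) (BinaryTuple n) with hπdef
  have hπ : ∀ x, 0 < π x := burnsideStationary_pos
  have h := sum_sq_le_sum_mul_sum_of_sq_le_mul (univ : Finset (BinaryTuple n))
    (r := fun y => |(K ^ s) x y - π y|) (f := fun y => ((K ^ s) x y - π y) ^ 2 / π y) (g := π)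
    (fun y _ => div_nonneg (sq_nonneg _) (hπ y).le) (fun y _ => (hπ y).le)
    (fun y _ => by rw [sq_abs, div_mul_cancel₀ _ (hπ y).ne'])
  rw [sum_burnsideStationary, mul_one] at h
  rw [binaryBurnsideTV, tvDist, ← mul_assoc, mul_one_div_cancel two_ne_zero, one_mul]
  exact h

theorem theorem1p1 :
    -- the explicit chi-square bounds
    (∀ n s : ℕ, 3 ≤ n → 3 ≤ s → ∀ j : Fin n,
      5 * (1 / 4 : ℝ) ^ (2 * s) ≤ binaryBurnsideChiSq n (oneOne n j) s ∧
      binaryBurnsideChiSq n (oneOne n j) s ≤ 270 * (1 / 4 : ℝ) ^ (2 * s)) ∧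
    -- a bounded number of steps suffices in chi-square distance
    (∀ ε : ℝ, 0 < ε → ∃ s₀ : ℕ, ∀ n : ℕ, 3 ≤ n → ∀ j : Fin n, ∀ s : ℕ, s₀ ≤ s →
      binaryBurnsideChiSq n (oneOne n j) s ≤ ε) ∧
    -- the number of steps has to grow, uniformly in `n`, as the target chi-square distance shrinks
    (∀ s₀ : ℕ, ∃ δ : ℝ, 0 < δ ∧ ∀ n : ℕ, 3 ≤ n → ∀ j : Fin n, ∀ s : ℕ, s ≤ s₀ →
      δ ≤ binaryBurnsideChiSq n (oneOne n j) s) ∧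
    -- the same two assertions in total variation distance
    (∀ ε : ℝ, 0 < ε → ∃ s₀ : ℕ, ∀ n : ℕ, 3 ≤ n → ∀ j : Fin n, ∀ s : ℕ, s₀ ≤ s →
      binaryBurnsideTV n (oneOne n j) s ≤ ε) ∧
    (∀ s₀ : ℕ, ∃ δ : ℝ, 0 < δ ∧ ∀ n : ℕ, 3 ≤ n → ∀ j : Fin n, ∀ s : ℕ, s ≤ s₀ →
      δ ≤ binaryBurnsideTV n (oneOne n j) s) := by
  have hsuff : ∀ ε : ℝ, 0 < ε → ∃ s₀ : ℕ, ∀ n : ℕ, 3 ≤ n → ∀ j : Fin n, ∀ s : ℕ, s₀ ≤ s →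
      binaryBurnsideChiSq n (oneOne n j) s ≤ ε := by
    intro ε hε
    obtain ⟨t, ht⟩ := exists_pow_lt_of_lt_one (show 0 < ε / 270 by positivity)
      (show (1 / 4 : ℝ) < 1 by norm_num)
    refine ⟨max 3 t, fun n _ j s hs => (binaryBurnsideChiSq_le (by omega) j).trans ?_⟩
    have h : (1 / 4 : ℝ) ^ (2 * s) ≤ (1 / 4) ^ t :=
      pow_le_pow_of_le_one (by norm_num) (by norm_num) (by omega)
    linarith
  refine ⟨fun n s hn hs j => ⟨le_binaryBurnsideChiSq hn j s, binaryBurnsideChiSq_le hs j⟩,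
    hsuff, fun s₀ => ⟨5 * (1 / 4 : ℝ) ^ (2 * s₀), by positivity, fun n hn j s hs => ?_⟩,
    fun ε hε => ?_, fun s₀ => ⟨1 / 2 * (1 / 4 : ℝ) ^ s₀, by positivity, fun n hn j s hs => ?_⟩⟩
  · refine le_trans ?_ (le_binaryBurnsideChiSq hn j s)
    have h : (1 / 4 : ℝ) ^ (2 * s₀) ≤ (1 / 4) ^ (2 * s) :=
      pow_le_pow_of_le_one (by norm_num) (by norm_num) (by omega)
    linarith
  · obtain ⟨s₀, h₀⟩ := hsuff ((2 * ε) ^ 2) (by positivity)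
    refine ⟨s₀, fun n hn j s hs => ?_⟩
    have h := (two_mul_tvDist_sq_le (oneOne n j) s).trans (h₀ n hn j s hs)
    have := le_of_sq_le_sq h (by positivity)
    linarith
  · refine le_trans ?_ (le_binaryBurnsideTV hn j s)
    have h : (1 / 4 : ℝ) ^ s₀ ≤ (1 / 4) ^ s :=
      pow_le_pow_of_le_one (by norm_num) (by norm_num) hs
    linarith
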